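/- There are infinitely many pairwise non-isomorphic finite groups $G$ such that every connected Cayley graph on $G$ has a hamiltonian cycle and $G$ is not solvable. Here, for a subset $S$ of $G$, the Cayley graph $\mathrm{Cay}(G;S)$ is the graph whose vertices are the elements of $G$, with edges joining $g$ to $gs$ and to $gs^{-1}$ for all $g\in G$ and $s\in S$ (loops and repeated edges being ignored); a hamiltonian cycle is a cycle that visits every vertex exactly once. -/

import Mathlib

open Classical in
/-- The graph `Γ` contains a hamiltonian cycle: a cycle that visits every vertex exactly once. -/
def HasHamiltonianCycle {V : Type*} (Γ : SimpleGraph V) : Prop :=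
  ∃ (v : V) (c : Γ.Walk v v), c.IsHamiltonianCycle

/-- Every connected Cayley graph on `G` has a hamiltonian cycle. In `SimpleGraph.mulCayley S`, the
vertices are the elements of `G`, and distinct `g`, `h` are adjacent when `h = g * s` or
`h = g * s⁻¹` for some `s ∈ S`; the connection set `S` is an arbitrary subset of `G`. -/
def ConnectedCayleyGraphsHamiltonian (G : Type*) [Group G] : Prop :=
  ∀ S : Set G, (SimpleGraph.mulCayley S).Connected →
    HasHamiltonianCycle (SimpleGraph.mulCayley S)

/-!
Let `p > 500` be a prime with `p ≡ 1` modulo `3`, and let `S` generate `G = A₅ × ℤ/pℤ`. If a word in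
`S` and its inverses projects to a hamiltonian cycle of `A₅` and its product in `ℤ/pℤ` is
nontrivial, then its `p`-th power is a hamiltonian cycle of `G`. This product is a monomial in the
`ℤ/pℤ`-components of the elements of `S`, with the exponent sums of the word as exponents. Hence, if
finitely many hamiltonian words in the same generators of `A₅` have a matrix of exponent sums with
determinant prime to `p`, then one of them lifts unless all of these components are trivial. A
finite search shows that, up to conjugation, the projection of every generating set contains a tuple
with such words, or else an involution and a `3`-cycle `b` which fail only if the component of the
involution is trivial. In that case, a hamiltonian cycle of `A₅ × ℤ/4ℤ` that uses all edges labelled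
`b` between two consecutive cosets of `A₅` is stretched by replacing these edges with paths of
length `p - 3`, which end at the right vertices because `b` has order `3` and `p ≡ 1` modulo `3`.

If all of the components are trivial, then `S` contains another element `(a, c)` with `c ≠ 1`. Use
it to pass from each coset of `A₅` to the next, following a hamiltonian path inside each coset. The
hamiltonian word in `A₅` provides paths with several possible endpoints, and as `A₅` is simple,
nonabelian and of order at most `p`, the endpoints can be chosen so that the walk closes up.
-/

open scoped Pointwise

/-- The vertices visited by the walk that starts at `g` and follows the steps in `w`,
except for its endpoint. -/
def walkVertices {G : Type*} [Mul G] : G → List G → List G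
  | _, [] => []
  | g, x :: w => g :: walkVertices (g * x) w

/-- The walk from `1` that follows the steps in `w` is closed and visits every element of `G`
exactly once. -/
structure IsHamiltonianWord {G : Type*} [Group G] (w : List G) : Prop where
  length_eq : w.length = Nat.card G
  prod_eq : w.prod = 1
  mem_vertices : ∀ g, g ∈ walkVertices 1 w

section WalkVertices

variable {G H : Type*} [Group G] [Group H]

@[simp] theorem walkVertices_nil (g : G) : walkVertices g [] = [] := rfl

@[simp] theorem walkVertices_cons (g x : G) (w : List G) :
    walkVertices g (x :: w) = g :: walkVertices (g * x) w := rfl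

@[simp] theorem length_walkVertices (g : G) (w : List G) :
    (walkVertices g w).length = w.length := by
  induction w generalizing g with
  | nil => rfl
  | cons x w ih => simp [ih]

theorem walkVertices_append (g : G) (u v : List G) :
    walkVertices g (u ++ v) = walkVertices g u ++ walkVertices (g * u.prod) v := by
  induction u generalizing g with
  | nil => simp
  | cons x u ih => simp [ih, mul_assoc]

theorem walkVertices_mul (h g : G) (w : List G) :
    walkVertices (h * g) w = (walkVertices g w).map (h * ·) := by
  induction w generalizing g with
  | nil => rfl
  | cons x w ih => simp [mul_assoc, ih]

theorem walkVertices_map (f : G →* H) (g : G) (w : List G) :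
    walkVertices (f g) (w.map f) = (walkVertices g w).map f := by
  induction w generalizing g with
  | nil => rfl
  | cons x w ih => simp [← map_mul, ih]

theorem walkVertices_one_map (f : G →* H) (w : List G) :
    walkVertices 1 (w.map f) = (walkVertices 1 w).map f := by
  rw [← walkVertices_map, map_one]

theorem mem_walkVertices_iff {g k : G} {w : List G} :
    k ∈ walkVertices g w ↔ g⁻¹ * k ∈ walkVertices 1 w := by
  rw [← mul_one g, walkVertices_mul, mul_one, List.mem_map]
  exact ⟨by rintro ⟨a, ha, rfl⟩; simpa using ha, fun hk => ⟨_, hk, by simp⟩⟩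

theorem mem_walkVertices_one_iff {k : G} {w : List G} :
    k ∈ walkVertices 1 w ↔ ∃ u v, w = u ++ v ∧ v ≠ [] ∧ u.prod = k := by
  constructor
  · induction w generalizing k with
    | nil => simp
    | cons x w ih =>
      intro hk
      rcases List.mem_cons.1 hk with rfl | hk
      · exact ⟨[], x :: w, by simp⟩
      · rw [one_mul, mem_walkVertices_iff] at hk
        obtain ⟨u, v, rfl, hv, hu⟩ := ih hk
        exact ⟨x :: u, v, rfl, hv, by simp [hu]⟩
  · rintro ⟨u, v, rfl, hv, rfl⟩
    rw [walkVertices_append]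
    cases v with
    | nil => exact absurd rfl hv
    | cons x v => simp

theorem mem_walkVertices_flatten {blocks : List (List G)} {k : ℕ} (hk : k < blocks.length) {g : G}
    (hg : g ∈ walkVertices 1 blocks[k]) :
    ((blocks.take k).map List.prod).prod * g ∈ walkVertices 1 blocks.flatten := by
  have hsplit : blocks.flatten = (blocks.take k ++ blocks[k] :: blocks.drop (k + 1)).flatten := by
    rw [← List.drop_eq_getElem_cons hk, List.take_append_drop]
  rw [hsplit, List.flatten_append, List.flatten_cons, walkVertices_append, walkVertices_append,
    List.mem_append, List.mem_append, mem_walkVertices_iff (g := 1 * _), one_mul,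
    List.prod_flatten, inv_mul_cancel_left]
  exact Or.inr (Or.inl hg)

theorem mem_walkVertices_flatten_replicate {w : List G} {g : G} (hg : g ∈ walkVertices 1 w)
    {k n : ℕ} (hk : k < n) :
    w.prod ^ k * g ∈ walkVertices 1 (List.replicate n w).flatten := by
  have h := mem_walkVertices_flatten (blocks := List.replicate n w) (by simpa using hk)
    (by simpa using hg)
  rwa [List.take_replicate, min_eq_left hk.le, List.map_replicate, List.prod_replicate] at h

theorem mul_pow_mem_walkVertices_replicate (g x : G) {k n : ℕ} (hk : k < n) :
    g * x ^ k ∈ walkVertices g (List.replicate n x) := by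
  have h := mem_walkVertices_flatten_replicate (w := [x]) (g := 1) (by simp) hk
  rw [mem_walkVertices_iff]
  simpa using h

theorem exists_walk_support_eq {S : Set G} (g : G) {h : G} (w : List G)
    (hw : ∀ x ∈ w, x ≠ 1 ∧ (x ∈ S ∨ x⁻¹ ∈ S)) (hprod : g * w.prod = h) :
    ∃ c : (SimpleGraph.mulCayley S).Walk g h, c.support = walkVertices g w ++ [h] := by
  induction w generalizing g with
  | nil =>
    obtain rfl : g = h := by simpa using hprod
    exact ⟨SimpleGraph.Walk.nil, by simp⟩
  | cons x w ih =>
    obtain ⟨c, hc⟩ := ih (g * x) (fun y hy => hw y (List.mem_cons_of_mem _ hy))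
      (by rw [← hprod, List.prod_cons, mul_assoc])
    obtain ⟨hx, hxS⟩ := hw x (by simp)
    have hadj : (SimpleGraph.mulCayley S).Adj g (g * x) := by
      rw [SimpleGraph.mulCayley_adj]
      exact ⟨by simpa using hx, by simpa using hxS⟩
    exact ⟨SimpleGraph.Walk.cons hadj c, by simp [hc]⟩

theorem closure_eq_top_of_mulCayley_connected {S : Set G}
    (h : (SimpleGraph.mulCayley S).Connected) : Subgroup.closure S = ⊤ := by
  have inv_mul_mem {u v : G} (c : (SimpleGraph.mulCayley S).Walk u v) :
      u⁻¹ * v ∈ Subgroup.closure S := by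
    induction c with
    | nil => simp
    | @cons u v w hadj _ ih =>
      rw [show u⁻¹ * w = (u⁻¹ * v) * (v⁻¹ * w) by group]
      refine Subgroup.mul_mem _ ?_ ih
      rw [SimpleGraph.mulCayley_adj] at hadj
      rcases hadj.2 with h | h
      · exact Subgroup.subset_closure h
      · simpa using Subgroup.inv_mem _ (Subgroup.subset_closure h)
  rw [eq_top_iff]
  intro g _
  obtain ⟨c⟩ := h.preconnected 1 g
  simpa using inv_mul_mem c

end WalkVertices

theorem mem_of_nodup_of_length_eq_card {α : Type*} [Finite α] {l : List α} (hl : l.Nodup)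
    (hcard : l.length = Nat.card α) (x : α) : x ∈ l := by
  classical
  have := Fintype.ofFinite α
  have huniv : l.toFinset = Finset.univ := by
    rw [← Finset.card_eq_iff_eq_univ, List.toFinset_card_of_nodup hl, hcard,
      Nat.card_eq_fintype_card]
  rw [← List.mem_toFinset, huniv]
  exact Finset.mem_univ x

namespace IsHamiltonianWord

variable {G H : Type*} [Group G] [Group H] {w : List G}

theorem finite (hw : IsHamiltonianWord w) : Finite G :=
  Set.finite_univ_iff.1 ((List.finite_toSet _).subset fun g _ => hw.mem_vertices g)

theorem nodup (hw : IsHamiltonianWord w) : (walkVertices 1 w).Nodup := by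
  classical
  have := hw.finite
  have := Fintype.ofFinite G
  have huniv : (walkVertices 1 w : Multiset G).toFinset = Finset.univ := by
    ext g; simpa using hw.mem_vertices g
  rw [← Multiset.coe_nodup, ← Multiset.toFinset_card_eq_card_iff_nodup, huniv, Finset.card_univ,
    Multiset.coe_card, length_walkVertices, hw.length_eq, Nat.card_eq_fintype_card]

theorem ne_one_of_mem (hw : IsHamiltonianWord w) (hG : 2 ≤ Nat.card G) {x : G}
    (hx : x ∈ w) : x ≠ 1 := by
  rintro rfl
  obtain ⟨u, v, rfl⟩ := List.append_of_mem hx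
  have hnodup := hw.nodup
  have hprod := hw.prod_eq
  have hlength := hw.length_eq
  rw [walkVertices_append] at hnodup
  cases v with
  | cons y v => simp [List.nodup_append] at hnodup
  | nil =>
    cases u with
    | nil =>
      rw [← hlength, List.nil_append, List.length_singleton] at hG
      omega
    | cons y u =>
      simp only [List.prod_append, List.prod_cons, List.prod_nil, mul_one] at hprod
      simp [hprod] at hnodup

theorem isCycle_of_support_eq (hw : IsHamiltonianWord w) (hG : 3 ≤ Nat.card G)
    {Γ : SimpleGraph G} {c : Γ.Walk 1 1} (hc : c.support = walkVertices 1 w ++ [1]) :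
    c.IsCycle := by
  have hlength : c.length = Nat.card G := by
    simpa [hw.length_eq] using congrArg List.length hc
  have hnil : ¬ c.Nil := by
    rw [← SimpleGraph.Walk.length_eq_zero_iff]; omega
  rw [SimpleGraph.Walk.isCycle_iff_isPath_tail_and_le_length, SimpleGraph.Walk.isPath_def,
    SimpleGraph.Walk.support_tail_of_not_nil _ hnil, hc]
  refine ⟨?_, by omega⟩
  have hnodup := hw.nodup
  cases w with
  | nil => simp
  | cons x w =>
    simp only [walkVertices_cons, List.cons_append, List.tail_cons, List.nodup_cons] at hnodup ⊢
    exact List.nodup_append_comm.1 (by simpa using hnodup)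

theorem hasHamiltonianCycle (hw : IsHamiltonianWord w) (hG : 3 ≤ Nat.card G)
    {S : Set G} (hS : ∀ x ∈ w, x ∈ S ∨ x⁻¹ ∈ S) :
    HasHamiltonianCycle (SimpleGraph.mulCayley S) := by
  classical
  have := hw.finite
  have := Fintype.ofFinite G
  obtain ⟨c, hc⟩ := exists_walk_support_eq (S := S) 1 (h := 1) w
    (fun x hx => ⟨hw.ne_one_of_mem (by omega) hx, hS x hx⟩) (by simp [hw.prod_eq])
  have hlength : c.length = Fintype.card G := by
    simpa [hw.length_eq, Nat.card_eq_fintype_card] using congrArg List.length hc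
  refine ⟨1, c, ?_⟩
  convert SimpleGraph.Walk.isHamiltonianCycle_iff_isCycle_and_length_eq.2
    ⟨hw.isCycle_of_support_eq hG hc, hlength⟩

theorem closure_eq_top (hw : IsHamiltonianWord w) : Subgroup.closure {x | x ∈ w} = ⊤ := by
  rw [eq_top_iff]
  intro g _
  obtain ⟨u, v, rfl, -, rfl⟩ := mem_walkVertices_one_iff.1 (hw.mem_vertices g)
  exact Subgroup.list_prod_mem _ fun x hx => Subgroup.subset_closure (by simp [hx])

theorem map (hw : IsHamiltonianWord w) (f : G ≃* H) : IsHamiltonianWord (w.map f) where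
  length_eq := by rw [List.length_map, hw.length_eq, Nat.card_congr f.toEquiv]
  prod_eq := by rw [List.prod_hom, hw.prod_eq, map_one]
  mem_vertices h := by
    have hvertices : walkVertices 1 (w.map f) = (walkVertices 1 w).map f :=
      walkVertices_one_map f.toMonoidHom w
    rw [hvertices, List.mem_map]
    exact ⟨f.symm h, hw.mem_vertices _, f.apply_symm_apply h⟩

theorem of_nodup_map [Finite G] {f : G →* H} (hf : Function.Injective f)
    (hlength : w.length = Nat.card G) (hprod : (w.map f).prod = 1)
    (hnodup : (walkVertices 1 (w.map f)).Nodup) : IsHamiltonianWord w where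
  length_eq := hlength
  prod_eq := hf (by rw [map_one, ← hprod, List.prod_hom])
  mem_vertices := by
    rw [walkVertices_one_map] at hnodup
    exact mem_of_nodup_of_length_eq_card hnodup.of_map (by rw [length_walkVertices, hlength])

theorem append_comm {u v : List G} (hw : IsHamiltonianWord (u ++ v)) :
    IsHamiltonianWord (v ++ u) := by
  have hprod : u.prod * v.prod = 1 := by simpa using hw.prod_eq
  have hv : (v.prod)⁻¹ = u.prod := (eq_inv_of_mul_eq_one_left hprod).symm
  refine ⟨by rw [← hw.length_eq, List.length_append, List.length_append, add_comm], ?_,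
    fun g => ?_⟩
  · rw [List.prod_append, ← hv, mul_inv_cancel]
  · have h := hw.mem_vertices (u.prod * g)
    rw [walkVertices_append, List.mem_append, one_mul, mem_walkVertices_iff (g := u.prod),
      inv_mul_cancel_left] at h
    rw [walkVertices_append, List.mem_append, one_mul, mem_walkVertices_iff (g := v.prod), hv]
    exact h.symm

theorem reverse_map_inv (hw : IsHamiltonianWord w) :
    IsHamiltonianWord (w.map (·⁻¹)).reverse := by
  refine ⟨by simpa using hw.length_eq, by rw [← List.prod_inv_reverse, hw.prod_eq, inv_one],
    fun g => ?_⟩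
  obtain ⟨u, v, rfl, hv, rfl⟩ := mem_walkVertices_one_iff.1 (hw.mem_vertices g)
  have hprod : v.prod⁻¹ = u.prod := by
    rw [eq_comm, ← mul_eq_one_iff_eq_inv, ← List.prod_append, hw.prod_eq]
  rw [mem_walkVertices_one_iff]
  cases u with
  | nil => exact ⟨[], _, rfl, by simpa using hv, rfl⟩
  | cons x u =>
    refine ⟨(v.map (·⁻¹)).reverse, ((x :: u).map (·⁻¹)).reverse, by simp, by simp, ?_⟩
    rw [← List.prod_inv_reverse, hprod]

end IsHamiltonianWord

theorem exists_pow_eq_of_orderOf_eq_card {C : Type*} [Group C] [Finite C] {c : C}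
    (hc : orderOf c = Nat.card C) (z : C) : ∃ k < Nat.card C, c ^ k = z := by
  have htop : Subgroup.zpowers c = ⊤ := by
    rw [← Subgroup.card_eq_iff_eq_top, Nat.card_zpowers, hc]
  obtain ⟨k, rfl⟩ := mem_powers_iff_mem_zpowers.2 (htop ▸ Subgroup.mem_top z)
  exact ⟨k % Nat.card C, Nat.mod_lt _ Nat.card_pos, by rw [← hc]; exact pow_mod_orderOf c k⟩

section FactorGroup

variable {A C : Type*} [Group A] [Group C]

/-- The factor group lemma, for a cyclic direct factor. -/
theorem IsHamiltonianWord.flatten_replicate_of_fst [Finite C] {w : List (A × C)}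
    (hw : IsHamiltonianWord (w.map Prod.fst)) (hc : orderOf w.prod.2 = Nat.card C) :
    IsHamiltonianWord (List.replicate (Nat.card C) w).flatten := by
  have hfst : w.prod.1 = 1 := by
    rw [← hw.prod_eq]
    exact map_list_prod (MonoidHom.fst A C) w
  have hpow (k : ℕ) : w.prod ^ k = (1, w.prod.2 ^ k) := by ext <;> simp [hfst]
  refine ⟨?_, ?_, ?_⟩
  · have hlength : w.length = Nat.card A := by rw [← hw.length_eq, List.length_map]
    simp [hlength, mul_comm]
  · rw [List.prod_flatten, List.map_replicate, List.prod_replicate, hpow, pow_card_eq_one']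
    rfl
  · rintro ⟨g, z⟩
    obtain ⟨y, hy⟩ : ∃ y, (g, y) ∈ walkVertices 1 w := by
      have hg : g ∈ (walkVertices 1 w).map Prod.fst :=
        walkVertices_one_map (MonoidHom.fst A C) w ▸ hw.mem_vertices g
      simpa using hg
    obtain ⟨k, hk, hz⟩ := exists_pow_eq_of_orderOf_eq_card hc (z * y⁻¹)
    simpa [hpow, hz] using mem_walkVertices_flatten_replicate hy hk

/-- The word over `A × C` that follows the word `u` within a coset of `A` and then takes the step
`(a, c)` to another coset. -/
def layerWord (a : A) (c : C) (u : List A) : List (A × C) :=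
  u.map (MonoidHom.inl A C) ++ [(a, c)]

theorem prod_layerWord (a : A) (c : C) (u : List A) : (layerWord a c u).prod = (u.prod * a, c) := by
  rw [layerWord, List.prod_append, List.prod_hom]
  simp

theorem mem_walkVertices_layerWord {u : List A} {x : A} (hu : IsHamiltonianWord (u ++ [x])) (a : A)
    (c : C) (g : A) : (g, (1 : C)) ∈ walkVertices 1 (layerWord a c u) := by
  have hg := hu.mem_vertices g
  rw [walkVertices_append, List.mem_append] at hg
  rw [layerWord, walkVertices_append, walkVertices_one_map, List.prod_hom, List.mem_append]
  refine hg.imp (fun h => List.mem_map_of_mem (f := MonoidHom.inl A C) h) fun h => ?_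
  simpa using h

theorem mem_walkVertices_flatten_layerWords (a : A) (c : C) {ws : List (List A)}
    (hws : ∀ u ∈ ws, ∃ x, IsHamiltonianWord (u ++ [x])) {k : ℕ} (hk : k < ws.length) (g : A) :
    (g, c ^ k) ∈ walkVertices 1 (ws.map (layerWord a c)).flatten := by
  set start : A × C := (((ws.map (layerWord a c)).take k).map List.prod).prod with hstart
  have hsnd : start.2 = c ^ k := by
    rw [hstart, ← MonoidHom.coe_snd, map_list_prod]
    simp [← List.map_take, Function.comp_def, prod_layerWord, min_eq_left hk.le]
  obtain ⟨x, hx⟩ := hws ws[k] (List.getElem_mem hk)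
  have hmem := mem_walkVertices_flatten (blocks := ws.map (layerWord a c)) (k := k)
    (by simpa using hk) (g := (start.1⁻¹ * g, 1))
    (by simpa using mem_walkVertices_layerWord hx a c (start.1⁻¹ * g))
  have heq : start * (start.1⁻¹ * g, 1) = (g, c ^ k) := by ext <;> simp [hsnd]
  rwa [← hstart, heq] at hmem

theorem isHamiltonianWord_flatten_layerWords [Finite C] {a : A} {c : C}
    (hc : orderOf c = Nat.card C) {ws : List (List A)} (hlength : ws.length = Nat.card C)
    (hws : ∀ u ∈ ws, ∃ x, IsHamiltonianWord (u ++ [x]))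
    (hprod : (ws.map fun u => u.prod * a).prod = 1) :
    IsHamiltonianWord (ws.map (layerWord a c)).flatten where
  length_eq := by
    have hlayer : ∀ u ∈ ws, (layerWord a c u).length = Nat.card A := fun u hu => by
      obtain ⟨x, hx⟩ := hws u hu
      rw [← hx.length_eq]
      simp [layerWord]
    have hmap : (ws.map (layerWord a c)).map List.length = ws.map fun _ => Nat.card A := by
      rw [List.map_map]
      exact List.map_congr_left hlayer
    rw [List.length_flatten, hmap, List.map_const', List.sum_replicate, hlength, smul_eq_mul,
      mul_comm, Nat.card_prod]
  prod_eq := by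
    rw [List.prod_flatten]
    ext
    · rw [← MonoidHom.coe_fst, map_list_prod]
      simpa [Function.comp_def, prod_layerWord] using hprod
    · rw [← MonoidHom.coe_snd, map_list_prod]
      simp [Function.comp_def, prod_layerWord, hlength]
  mem_vertices := by
    rintro ⟨g, z⟩
    obtain ⟨k, hk, rfl⟩ := exists_pow_eq_of_orderOf_eq_card hc z
    exact mem_walkVertices_flatten_layerWords a c hws (by rwa [hlength]) g

theorem normal_closure_mul_self {L : Set A} (hinv : ∀ x ∈ L, x⁻¹ ∈ L)
    (hL : Subgroup.closure L = ⊤) : (Subgroup.closure (L * L)).Normal := by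
  have conj_mem : ∀ x ∈ L, ∀ h ∈ Subgroup.closure (L * L),
      x * h * x⁻¹ ∈ Subgroup.closure (L * L) := by
    intro x hx h hh
    induction hh using Subgroup.closure_induction with
    | mem z hz =>
      obtain ⟨u, hu, v, hv, rfl⟩ := hz
      rw [show x * (u * v) * x⁻¹ = (x * u) * (v * x⁻¹) by group]
      exact Subgroup.mul_mem _ (Subgroup.subset_closure (Set.mul_mem_mul hx hu))
        (Subgroup.subset_closure (Set.mul_mem_mul hv (hinv x hx)))
    | one => simp
    | mul y z _ _ hy hz => rw [conj_mul.symm]; exact Subgroup.mul_mem _ hy hz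
    | inv y _ hy => rw [conj_inv.symm]; exact Subgroup.inv_mem _ hy
  rw [← Subgroup.normalizer_eq_top_iff, eq_top_iff, ← hL, Subgroup.closure_le]
  intro x hx
  rw [SetLike.mem_coe, Subgroup.mem_normalizer_iff]
  refine fun h => ⟨conj_mem x hx h, fun hh => ?_⟩
  simpa [mul_assoc] using conj_mem _ (hinv x hx) _ hh

theorem closure_mul_self_eq_top [IsSimpleGroup A] (hA : ¬ Group.IsSolvable A) {L : Set A}
    (hinv : ∀ x ∈ L, x⁻¹ ∈ L) (hL : Subgroup.closure L = ⊤) : Subgroup.closure (L * L) = ⊤ := by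
  have := normal_closure_mul_self hinv hL
  refine (IsSimpleGroup.eq_bot_or_eq_top_of_normal _ this).resolve_left fun hbot => hA ?_
  have eq_of_mem : ∀ x ∈ L, ∀ y ∈ L, x = y := fun x hx y hy => by
    have hmem : x * y⁻¹ ∈ Subgroup.closure (L * L) :=
      Subgroup.subset_closure (Set.mul_mem_mul hx (hinv y hy))
    rwa [hbot, Subgroup.mem_bot, mul_inv_eq_one] at hmem
  have := Subgroup.isMulCommutative_closure fun x hx y hy => by rw [eq_of_mem x hx y hy]
  rw [hL] at this
  exact Group.isSolvable_of_comm fun x y =>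
    setLike_mul_comm (s := (⊤ : Subgroup A)) (Subgroup.mem_top x) (Subgroup.mem_top y)

/-- As `L` is closed under inversion, the quotients of two elements of the coset `L * a` are the
elements of `L * L`, which generate `A`. -/
theorem image_mul_right_pow_eq_univ [Finite A] [IsSimpleGroup A] (hA : ¬ Group.IsSolvable A)
    {L : Set A} (hinv : ∀ x ∈ L, x⁻¹ ∈ L) (hL : Subgroup.closure L = ⊤) (a : A) {n : ℕ}
    (hn : Nat.card A ≤ n) : ((· * a) '' L) ^ n = Set.univ := by
  have := Fintype.ofFinite A
  set X := (· * a) '' L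
  have hX : X.Nonempty := by
    refine Set.Nonempty.image _ (Set.nonempty_iff_ne_empty.2 ?_)
    rintro rfl
    simp at hL
  have mul_mem : L * L ⊆ X ^ Fintype.card A := by
    rintro _ ⟨x, hx, y, hy, rfl⟩
    have hcard : Fintype.card A = Fintype.card A - 1 + 1 := by
      have := Fintype.card_pos (α := A); omega
    have hpow : (y⁻¹ * a) ^ (Fintype.card A - 1) = (y⁻¹ * a)⁻¹ := by
      rw [eq_inv_iff_mul_eq_one, ← pow_succ, ← hcard, pow_card_eq_one]
    have hxy : x * y = (x * a) * (y⁻¹ * a) ^ (Fintype.card A - 1) := by rw [hpow]; group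
    rw [hcard, pow_succ', Set.mem_mul]
    exact ⟨x * a, ⟨x, hx, rfl⟩, _, Set.pow_mem_pow ⟨_, hinv y hy, rfl⟩, hxy.symm⟩
  have htop : powCardSubgroup X hX = ⊤ := by
    rw [eq_top_iff, ← closure_mul_self_eq_top hA hinv hL, Subgroup.closure_le]
    exact mul_mem
  have huniv : X ^ Fintype.card A = Set.univ := congrArg (SetLike.coe : Subgroup A → Set A) htop
  rw [Nat.card_eq_fintype_card] at hn
  obtain ⟨m, rfl⟩ := Nat.exists_eq_add_of_le hn
  rw [pow_add, huniv, Set.univ_mul hX.pow]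

theorem IsHamiltonianWord.exists_append_singleton {w : List A} (hw : IsHamiltonianWord w) {x : A}
    (hx : x ∈ w) : ∃ u, IsHamiltonianWord (u ++ [x]) ∧ ∀ y ∈ u, y ∈ w := by
  obtain ⟨u, v, rfl⟩ := List.append_of_mem hx
  refine ⟨v ++ u, ?_, by simp +contextual [or_imp]⟩
  rw [List.append_assoc]
  exact IsHamiltonianWord.append_comm (u := u ++ [x]) (by simpa using hw)

theorem IsHamiltonianWord.exists_prod_eq {w : List A} (hw : IsHamiltonianWord w) {x : A}
    (hx : x ∈ w ∨ x⁻¹ ∈ w) :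
    ∃ u : List A, u.prod = x ∧ IsHamiltonianWord (u ++ [x⁻¹]) ∧ ∀ y ∈ u, y ∈ w ∨ y⁻¹ ∈ w := by
  have prod_eq {u : List A} (hu : IsHamiltonianWord (u ++ [x⁻¹])) : u.prod = x := by
    simpa [mul_inv_eq_one] using hu.prod_eq
  rcases hx with hx | hx
  · obtain ⟨u, hu, hmem⟩ :=
      hw.reverse_map_inv.exists_append_singleton (x := x⁻¹) (by simpa using hx)
    exact ⟨u, prod_eq hu, hu, fun y hy => Or.inr (by simpa using hmem y hy)⟩
  · obtain ⟨u, hu, hmem⟩ := hw.exists_append_singleton hx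
    exact ⟨u, prod_eq hu, hu, fun y hy => Or.inl (hmem y hy)⟩

theorem IsHamiltonianWord.exists_isHamiltonianWord_prod [IsSimpleGroup A] [Finite C]
    (hA : ¬ Group.IsSolvable A) {w : List A} (hw : IsHamiltonianWord w) (a : A) {c : C}
    (hc : orderOf c = Nat.card C) (hcard : Nat.card A ≤ Nat.card C) :
    ∃ v : List (A × C), IsHamiltonianWord v ∧
      ∀ x ∈ v, x = (a, c) ∨ (x.1 ∈ w ∨ x.1⁻¹ ∈ w) ∧ x.2 = 1 := by
  have := hw.finite
  set L : Set A := {x | x ∈ w ∨ x⁻¹ ∈ w}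
  have hL : Subgroup.closure L = ⊤ :=
    top_le_iff.1 (hw.closure_eq_top.ge.trans (Subgroup.closure_mono fun x => Or.inl))
  have hinv : ∀ x ∈ L, x⁻¹ ∈ L := fun x hx => hx.symm.imp id (by simpa using ·)
  obtain ⟨f, hf⟩ : ∃ f : Fin (Nat.card C) → ((· * a) '' L),
      (List.ofFn fun i => (f i : A)).prod = 1 :=
    Set.mem_pow.1 (image_mul_right_pow_eq_univ hA hinv hL a hcard ▸ Set.mem_univ 1)
  choose x hxL hx using fun i => (f i).2
  choose u hprod hu hmem using fun i => hw.exists_prod_eq (hxL i)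
  refine ⟨((List.ofFn u).map (layerWord a c)).flatten, isHamiltonianWord_flatten_layerWords hc
    List.length_ofFn (fun v hv => ?_) ?_, fun y hy => ?_⟩
  · obtain ⟨i, rfl⟩ := (List.mem_ofFn' _ _).1 hv
    exact ⟨_, hu i⟩
  · simp only [List.map_ofFn, Function.comp_def, hprod]
    simpa only [hx] using hf
  · obtain ⟨_, hlayer, hy⟩ := List.mem_flatten.1 hy
    obtain ⟨v, hv, rfl⟩ := List.mem_map.1 hlayer
    obtain ⟨i, rfl⟩ := (List.mem_ofFn' _ _).1 hv
    rcases List.mem_append.1 hy with hy | hy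
    · obtain ⟨z, hz, rfl⟩ := List.mem_map.1 hy
      exact Or.inr ⟨hmem i z hz, rfl⟩
    · exact Or.inl (by simpa using hy)

end FactorGroup

/-- Words in the generators indexed by `ι` and their inverses: the letter `(i, true)` stands for
the generator `i` and `(i, false)` for its inverse. -/
abbrev Word (ι : Type*) := List (ι × Bool)

/-- The element of `G` denoted by a letter. -/
def evalLetter {ι G : Type*} [Group G] (s : ι → G) (x : ι × Bool) : G :=
  cond x.2 (s x.1) (s x.1)⁻¹

theorem map_evalLetter {ι G H F : Type*} [Group G] [Group H] [FunLike F G H] [MonoidHomClass F G H]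
    (f : F) (s : ι → G) (x : ι × Bool) : f (evalLetter s x) = evalLetter (fun i => f (s i)) x := by
  rcases x with ⟨i, _ | _⟩ <;> simp [evalLetter]

section Stretch

variable {A C : Type*} [Group A] [Group C]

/-- Consider the walks on four cyclically arranged layers in which the generator `0` stays within a
layer and the generator `1` moves up by one layer. A step crosses if it moves between the layers
`3` and `0`. -/
def Crosses (k : Multiplicative (ZMod 4)) (x : Fin 2 × Bool) : Prop :=
  x = (1, true) ∧ k = Multiplicative.ofAdd 3 ∨ x = (1, false) ∧ k = 1

instance (k : Multiplicative (ZMod 4)) (x : Fin 2 × Bool) : Decidable (Crosses k x) :=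
  inferInstanceAs (Decidable (_ ∨ _))

/-- The steps that replace a step out of the layer `k` when `r - 1` layers are inserted between the
layers `3` and `0`. -/
def stretchStep (r : ℕ) (k : Multiplicative (ZMod 4)) (x : Fin 2 × Bool) : Word (Fin 2) :=
  List.replicate (if Crosses k x then r else 1) x

/-- The word that replaces a word starting in the layer `k` when `r - 1` layers are inserted between
the layers `3` and `0`. -/
def stretch (r : ℕ) : Multiplicative (ZMod 4) → Word (Fin 2) → Word (Fin 2)
  | _, [] => []
  | k, x :: w =>
    stretchStep r k x ++ stretch r (k * evalLetter ![1, Multiplicative.ofAdd 1] x) w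

/-- The generators of `A × ℤ/4ℤ` that describe walks on four copies of `A`. -/
def layerGenerators (a b : A) : Fin 2 → A × Multiplicative (ZMod 4) :=
  ![(a, 1), (b, Multiplicative.ofAdd 1)]

/-- The elements `g` for which the edge between `(g, 3)` and `(g * b, 0)` is used by a walk. -/
def crossings (a b : A) : A × Multiplicative (ZMod 4) → Word (Fin 2) → List A
  | _, [] => []
  | s, x :: w =>
    (if Crosses s.2 x then [cond x.2 s.1 (s.1 * b⁻¹)] else []) ++
      crossings a b (s * evalLetter (layerGenerators a b) x) w

/-- The position of a vertex on four layers after layers have been inserted above the layer `3`. -/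
def stretchVertex (c : C) (s : A × Multiplicative (ZMod 4)) : A × C := (s.1, c ^ s.2.toAdd.val)

variable {a b : A} {c : C} {m : ℕ}

theorem snd_evalLetter_layerGenerators (x : Fin 2 × Bool) :
    (evalLetter (layerGenerators a b) x).2 = evalLetter ![1, Multiplicative.ofAdd 1] x := by
  rcases x with ⟨i, _ | _⟩ <;> fin_cases i <;> rfl

theorem crossings_map {A' : Type*} [Group A'] (f : A →* A') (s : A × Multiplicative (ZMod 4))
    (w : Word (Fin 2)) :
    crossings (f a) (f b) (f s.1, s.2) w = (crossings a b s w).map f := by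
  induction w generalizing s with
  | nil => rfl
  | cons x w ih =>
    have hstep : ((f s.1, s.2) : A' × _) * evalLetter (layerGenerators (f a) (f b)) x =
        (f (s * evalLetter (layerGenerators a b) x).1,
          (s * evalLetter (layerGenerators a b) x).2) := by
      rcases x with ⟨i, _ | _⟩ <;> fin_cases i <;> simp [evalLetter, layerGenerators]
    rw [crossings, crossings, hstep, ih, List.map_append]
    rcases x with ⟨i, _ | _⟩ <;> split_ifs <;> simp

theorem length_stretch (s : A × Multiplicative (ZMod 4)) (w : Word (Fin 2)) :
    (stretch (3 * m + 1) s.2 w).length = w.length + 3 * m * (crossings a b s w).length := by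
  induction w generalizing s with
  | nil => simp [stretch, crossings]
  | cons x w ih =>
    rw [stretch, crossings, ← snd_evalLetter_layerGenerators (a := a) (b := b), ← Prod.snd_mul,
      List.length_append, ih]
    rw [stretchStep]
    split_ifs <;> simp <;> ring

theorem pow_three_mul_add_one_eq_self (hb : b ^ 3 = 1) : b ^ (3 * m + 1) = b := by
  rw [pow_succ, pow_mul, hb, one_pow, one_mul]

theorem stretchVertex_mul_prod_stretchStep (hb : b ^ 3 = 1) (hc : c ^ (3 * m + 4) = 1)
    (s : A × Multiplicative (ZMod 4)) (x : Fin 2 × Bool) :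
    stretchVertex c s *
        ((stretchStep (3 * m + 1) s.2 x).map (evalLetter ![(a, 1), (b, c)])).prod =
      stretchVertex c (s * evalLetter (layerGenerators a b) x) := by
  have hc_inv : (c ^ (3 * m + 1))⁻¹ = c ^ 3 := inv_eq_of_mul_eq_one_right (by rw [← pow_add, hc])
  have hb_pow := pow_three_mul_add_one_eq_self (m := m) hb
  have val_add_one : ∀ k : ZMod 4, k ≠ 3 → (k + 1).val = k.val + 1 := by decide
  have val_sub_one : ∀ k : ZMod 4, k ≠ 0 → k.val = (k + -1).val + 1 := by decide
  obtain ⟨g, k⟩ := s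
  rw [stretchStep, List.map_replicate, List.prod_replicate]
  rcases x with ⟨i, _ | _⟩ <;> fin_cases i <;>
    simp only [stretchVertex, evalLetter, layerGenerators, Crosses]
  · simp
  · by_cases hk : k = 1
    · subst hk
      have hval : (-1 : ZMod 4).val = 3 := rfl
      simp [hb_pow, hc_inv, hval]
    · have hval := val_sub_one k.toAdd hk
      simp [hk, hval, pow_succ]
  · simp
  · by_cases hk : k = Multiplicative.ofAdd 3
    · subst hk
      have hval : (3 : ZMod 4).val = 3 ∧ (3 + 1 : ZMod 4).val = 0 := ⟨rfl, rfl⟩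
      simp [hb_pow, hval, ← hc_inv]
    · have hval := val_add_one k.toAdd hk
      simp [hk, hval, pow_succ]

theorem stretchVertex_mul_prod_stretch (hb : b ^ 3 = 1) (hc : c ^ (3 * m + 4) = 1)
    (s : A × Multiplicative (ZMod 4)) (w : Word (Fin 2)) :
    stretchVertex c s * ((stretch (3 * m + 1) s.2 w).map (evalLetter ![(a, 1), (b, c)])).prod =
      stretchVertex c (s * (w.map (evalLetter (layerGenerators a b))).prod) := by
  induction w generalizing s with
  | nil => simp [stretch]
  | cons x w ih =>
    rw [stretch, ← snd_evalLetter_layerGenerators (a := a) (b := b), ← Prod.snd_mul,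
      List.map_append, List.prod_append, ← mul_assoc, stretchVertex_mul_prod_stretchStep hb hc, ih,
      List.map_cons, List.prod_cons, mul_assoc]

theorem walkVertices_stretch_cons (hb : b ^ 3 = 1) (hc : c ^ (3 * m + 4) = 1)
    (s : A × Multiplicative (ZMod 4)) (x : Fin 2 × Bool) (w : Word (Fin 2)) :
    walkVertices (stretchVertex c s)
        ((stretch (3 * m + 1) s.2 (x :: w)).map (evalLetter ![(a, 1), (b, c)])) =
      walkVertices (stretchVertex c s)
          ((stretchStep (3 * m + 1) s.2 x).map (evalLetter ![(a, 1), (b, c)])) ++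
        walkVertices (stretchVertex c (s * evalLetter (layerGenerators a b) x))
          ((stretch (3 * m + 1) (s * evalLetter (layerGenerators a b) x).2 w).map
            (evalLetter ![(a, 1), (b, c)])) := by
  rw [stretch, List.map_append, walkVertices_append, stretchVertex_mul_prod_stretchStep hb hc,
    Prod.snd_mul, snd_evalLetter_layerGenerators]

theorem stretchVertex_mem_walkVertices (hb : b ^ 3 = 1) (hc : c ^ (3 * m + 4) = 1)
    {s t : A × Multiplicative (ZMod 4)} {w : Word (Fin 2)}
    (ht : t ∈ walkVertices s (w.map (evalLetter (layerGenerators a b)))) :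
    stretchVertex c t ∈ walkVertices (stretchVertex c s)
      ((stretch (3 * m + 1) s.2 w).map (evalLetter ![(a, 1), (b, c)])) := by
  induction w generalizing s with
  | nil => simp at ht
  | cons x w ih =>
    rw [walkVertices_stretch_cons hb hc, List.mem_append]
    rcases List.mem_cons.1 ht with rfl | ht
    · left
      rw [stretchStep]
      split_ifs <;> simp [List.replicate_succ]
    · exact Or.inr (ih ht)

theorem mem_walkVertices_stretchStep (hb : b ^ 3 = 1) (hc : c ^ (3 * m + 4) = 1)
    {s : A × Multiplicative (ZMod 4)} {x : Fin 2 × Bool} (hx : Crosses s.2 x) {i : ℕ}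
    (hi : 1 ≤ i) (him : i ≤ 3 * m) :
    (cond x.2 s.1 (s.1 * b⁻¹) * b ^ i, c ^ (3 + i)) ∈ walkVertices (stretchVertex c s)
      ((stretchStep (3 * m + 1) s.2 x).map (evalLetter ![(a, 1), (b, c)])) := by
  obtain ⟨g, k⟩ := s
  have hmem (y : A × C) {j : ℕ} (hj : j < 3 * m + 1) :=
    mul_pow_mem_walkVertices_replicate (stretchVertex c (g, k)) y hj
  rw [stretchStep, if_pos hx, List.map_replicate]
  rcases hx with ⟨rfl, rfl⟩ | ⟨rfl, rfl⟩
  · have hvertex : stretchVertex c (g, Multiplicative.ofAdd 3) * (b, c) ^ i =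
        (g * b ^ i, c ^ (3 + i)) := by
      simp [stretchVertex, pow_add, show (3 : ZMod 4).val = 3 from rfl]
    exact hvertex ▸ hmem (b, c) (by omega)
  · have hb_pow : b ^ i * b ^ (3 * m + 1 - i) = b := by
      rw [← pow_add, Nat.add_sub_cancel' (by omega), pow_three_mul_add_one_eq_self hb]
    have hc_pow : c ^ (3 + i) * c ^ (3 * m + 1 - i) = 1 := by
      rw [← pow_add, ← hc]
      congr 1
      omega
    have hvertex : stretchVertex c (g, 1) * (b, c)⁻¹ ^ (3 * m + 1 - i) =
        (g * b⁻¹ * b ^ i, c ^ (3 + i)) := by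
      rw [eq_inv_of_mul_eq_one_left hc_pow, mul_assoc, eq_mul_inv_of_mul_eq hb_pow]
      simp [stretchVertex]
    exact hvertex ▸ hmem (b, c)⁻¹ (by omega)

theorem mem_walkVertices_stretch_of_mem_crossings (hb : b ^ 3 = 1) (hc : c ^ (3 * m + 4) = 1)
    {s : A × Multiplicative (ZMod 4)} {w : Word (Fin 2)} {g : A} (hg : g ∈ crossings a b s w)
    {i : ℕ} (hi : 1 ≤ i) (him : i ≤ 3 * m) :
    (g * b ^ i, c ^ (3 + i)) ∈ walkVertices (stretchVertex c s)
      ((stretch (3 * m + 1) s.2 w).map (evalLetter ![(a, 1), (b, c)])) := by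
  induction w generalizing s with
  | nil => simp [crossings] at hg
  | cons x w ih =>
    rw [walkVertices_stretch_cons hb hc, List.mem_append]
    rcases List.mem_append.1 hg with hg | hg
    · split_ifs at hg with hx
      · rw [List.mem_singleton.1 hg]
        exact Or.inl (mem_walkVertices_stretchStep hb hc hx hi him)
      · simp at hg
    · exact Or.inr (ih hg)

/-- A hamiltonian word on four layers that uses all of the edges between the layers `3` and `0` can
be stretched to any number `3 * m + 4` of layers: the new vertices lie on the paths that replace
these edges. -/
theorem isHamiltonianWord_stretch (hb : b ^ 3 = 1) (hc : orderOf c = Nat.card C)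
    (hcard : Nat.card C = 3 * m + 4) {w : Word (Fin 2)}
    (hw : IsHamiltonianWord (w.map (evalLetter (layerGenerators a b))))
    (hlength : (crossings a b 1 w).length = Nat.card A) (hcrossings : ∀ g, g ∈ crossings a b 1 w) :
    IsHamiltonianWord ((stretch (3 * m + 1) 1 w).map (evalLetter ![(a, 1), (b, c)])) := by
  have := Nat.finite_of_card_ne_zero (α := C) (by omega)
  have hc_pow : c ^ (3 * m + 4) = 1 := by rw [← hcard, pow_card_eq_one']
  have hone : stretchVertex c (1 : A × Multiplicative (ZMod 4)) = 1 := by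
    simp [stretchVertex]
  refine ⟨?_, ?_, ?_⟩
  · have hbase : w.length = Nat.card A * 4 := by simpa using hw.length_eq
    rw [List.length_map, show (1 : Multiplicative (ZMod 4)) = (1 : A × _).2 from rfl,
      length_stretch (a := a) (b := b), hlength, hbase, Nat.card_prod, hcard]
    ring
  · simpa [hone, hw.prod_eq] using stretchVertex_mul_prod_stretch (a := a) hb hc_pow 1 w
  · rintro ⟨g, z⟩
    obtain ⟨k, hk, rfl⟩ := exists_pow_eq_of_orderOf_eq_card hc z
    rw [← hone]
    by_cases hk4 : k < 4
    · have hvertex : stretchVertex c (g, Multiplicative.ofAdd (k : ZMod 4)) = (g, c ^ k) := by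
        rw [stretchVertex, toAdd_ofAdd, ZMod.val_cast_of_lt hk4]
      exact hvertex ▸ stretchVertex_mem_walkVertices hb hc_pow (hw.mem_vertices (g, _))
    · have h := mem_walkVertices_stretch_of_mem_crossings hb hc_pow
        (hcrossings (g * (b ^ (k - 3))⁻¹)) (i := k - 3) (by omega) (by omega)
      rwa [inv_mul_cancel_right, Nat.add_sub_cancel' (by omega)] at h

end Stretch

section Lifts

variable {ι A C : Type*} [Group A]

/-- The exponent sum of the generator `i` in a word. -/
def exponent [DecidableEq ι] (i : ι) (w : Word ι) : ℤ := w.count (i, true) - w.count (i, false)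

theorem exponent_cons [DecidableEq ι] (i : ι) (x : ι × Bool) (w : Word ι) :
    exponent i (x :: w) = exponent i w + if x.1 = i then cond x.2 1 (-1) else 0 := by
  rcases x with ⟨j, _ | _⟩ <;> by_cases hij : j = i <;>
    simp [exponent, hij] <;> ring

theorem prod_map_evalLetter [Fintype ι] [DecidableEq ι] [CommGroup C] (z : ι → C) (w : Word ι) :
    (w.map (evalLetter z)).prod = ∏ i, z i ^ exponent i w := by
  induction w with
  | nil => simp [exponent]
  | cons x w ih =>
    have hexponent (i : ι) :
        z i ^ exponent i (x :: w) = z i ^ exponent i w * if x.1 = i then evalLetter z x else 1 := by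
      rw [exponent_cons]
      rcases x with ⟨j, _ | _⟩ <;> by_cases hij : j = i <;> simp [evalLetter, hij, zpow_add]
    simp only [List.map_cons, List.prod_cons, ih, hexponent, Finset.prod_mul_distrib,
      Finset.prod_ite_eq, Finset.mem_univ, if_true]
    exact mul_comm _ _

theorem zpow_sum [CommGroup C] (x : C) (f : ι → ℤ) (s : Finset ι) :
    x ^ ∑ i ∈ s, f i = ∏ i ∈ s, x ^ f i :=
  congrArg Additive.toMul (Finset.sum_smul (f := f) (s := s) (x := Additive.ofMul x))

theorem zpow_det_eq_one [Fintype ι] [DecidableEq ι] [CommGroup C] {M : Matrix ι ι ℤ} {z : ι → C}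
    (hz : ∀ k, ∏ i, z i ^ M k i = 1) (j : ι) : z j ^ M.det = 1 := by
  calc z j ^ M.det = ∏ i, z i ^ (M.adjugate * M) j i := by
        rw [Matrix.adjugate_mul]
        simp [Matrix.one_apply]
    _ = ∏ i, ∏ k, (z i ^ M k i) ^ M.adjugate j k := by
        simp only [Matrix.mul_apply, mul_comm (M.adjugate j _), zpow_sum, zpow_mul]
    _ = ∏ k, (∏ i, z i ^ M k i) ^ M.adjugate j k := by
        rw [Finset.prod_comm]
        simp only [Finset.prod_zpow]
    _ = 1 := by simp [hz]

variable [CommGroup C]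

variable (C) in
/-- The tuple `s` has a hamiltonian word in `A`, and every lift of `s` to `A × C` with an entry
outside `A` has one in `A × C`. -/
def HasHamiltonianLifts (s : ι → A) : Prop :=
  (∃ w : Word ι, IsHamiltonianWord (w.map (evalLetter s))) ∧
    ∀ z : ι → C, (∃ i, z i ≠ 1) →
      ∃ w : Word ι, IsHamiltonianWord (w.map (evalLetter fun i => (s i, z i)))

theorem IsHamiltonianWord.map_generators {B : Type*} [Group B] {s : ι → A} {w : Word ι}
    (hw : IsHamiltonianWord (w.map (evalLetter s))) (f : A ≃* B) :
    IsHamiltonianWord (w.map (evalLetter fun i => f (s i))) := by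
  have h := hw.map f
  rw [List.map_map] at h
  rwa [List.map_congr_left fun x _ => (map_evalLetter f s x).symm]

theorem HasHamiltonianLifts.map {B : Type*} [Group B] {s : ι → A} (hs : HasHamiltonianLifts C s)
    (f : A ≃* B) : HasHamiltonianLifts C fun i => f (s i) := by
  refine ⟨hs.1.imp fun w hw => hw.map_generators f, fun z hz => ?_⟩
  exact (hs.2 z hz).imp fun w hw => hw.map_generators (f.prodCongr (MulEquiv.refl C))

theorem orderOf_eq_card_of_prime_card [Fact (Nat.card C).Prime] {z : C} (hz : z ≠ 1) :
    orderOf z = Nat.card C :=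
  orderOf_eq_prime pow_card_eq_one' hz

theorem IsHamiltonianWord.exists_lift [Fintype ι] [DecidableEq ι] [hC : Fact (Nat.card C).Prime]
    {s : ι → A} {w : Word ι} (hw : IsHamiltonianWord (w.map (evalLetter s))) {z : ι → C}
    (hz : ∏ i, z i ^ exponent i w ≠ 1) :
    ∃ v : Word ι, IsHamiltonianWord (v.map (evalLetter fun i => (s i, z i))) := by
  have := Nat.finite_of_card_ne_zero hC.out.ne_zero
  have map_fst : (w.map (evalLetter fun i => (s i, z i))).map Prod.fst = w.map (evalLetter s) := by
    rw [List.map_map]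
    exact List.map_congr_left fun x _ => map_evalLetter (MonoidHom.fst A C) _ x
  have map_snd : (w.map (evalLetter fun i => (s i, z i))).map Prod.snd = w.map (evalLetter z) := by
    rw [List.map_map]
    exact List.map_congr_left fun x _ => map_evalLetter (MonoidHom.snd A C) _ x
  refine ⟨(List.replicate (Nat.card C) w).flatten, ?_⟩
  rw [List.map_flatten, List.map_replicate]
  refine IsHamiltonianWord.flatten_replicate_of_fst (by rwa [map_fst])
    (orderOf_eq_card_of_prime_card ?_)
  rwa [← MonoidHom.coe_snd, map_list_prod, MonoidHom.coe_snd, map_snd, prod_map_evalLetter]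

theorem hasHamiltonianLifts_of_det [Fintype ι] [DecidableEq ι] [Nonempty ι]
    [Fact (Nat.card C).Prime] {s : ι → A} {w : ι → Word ι}
    (hw : ∀ k, IsHamiltonianWord ((w k).map (evalLetter s)))
    (hdet : ¬ (Nat.card C : ℤ) ∣ (Matrix.of fun k i => exponent i (w k)).det) :
    HasHamiltonianLifts C s := by
  refine ⟨⟨_, hw (Classical.arbitrary ι)⟩, fun z ⟨j, hj⟩ => ?_⟩
  suffices h : ∃ k, ∏ i, z i ^ exponent i (w k) ≠ 1 by
    obtain ⟨k, hk⟩ := h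
    exact (hw k).exists_lift hk
  by_contra! h
  refine hdet ?_
  rw [← orderOf_eq_card_of_prime_card hj, orderOf_dvd_iff_zpow_eq_one]
  exact zpow_det_eq_one h j

theorem exists_snd_ne_one_of_closure_eq_top [Nontrivial C] {S : Set (A × C)}
    (hS : Subgroup.closure S = ⊤) : ∃ x ∈ S, x.2 ≠ 1 := by
  by_contra! h
  have hle : (⊤ : Subgroup (A × C)) ≤ (MonoidHom.snd A C).ker := hS ▸ (Subgroup.closure_le _).2 h
  obtain ⟨c, hc⟩ := exists_ne (1 : C)
  exact hc (hle (Subgroup.mem_top ((1, c) : A × C)))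

theorem HasHamiltonianLifts.hasHamiltonianCycle [IsSimpleGroup A]
    (hA : ¬ Group.IsSolvable A) [hC : Fact (Nat.card C).Prime] (hcard : Nat.card A ≤ Nat.card C)
    {s : ι → A} (hs : HasHamiltonianLifts C s) {S : Set (A × C)} (hS : Subgroup.closure S = ⊤)
    (hsS : ∀ i, ∃ c, (s i, c) ∈ S ∨ (s i, c)⁻¹ ∈ S) :
    HasHamiltonianCycle (SimpleGraph.mulCayley S) := by
  have := Nat.finite_of_card_ne_zero hC.out.ne_zero
  obtain ⟨w₀, hw₀⟩ := hs.1
  have := hw₀.finite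
  have three_le : 3 ≤ Nat.card (A × C) := by
    rw [Nat.card_prod]
    have : 2 ≤ Nat.card A := Finite.one_lt_card
    have := hC.out.two_le
    nlinarith
  choose z hz using hsS
  have letter_mem (x : ι × Bool) :
      evalLetter (fun i => (s i, z i)) x ∈ S ∨ (evalLetter (fun i => (s i, z i)) x)⁻¹ ∈ S := by
    rcases x with ⟨i, _ | _⟩ <;> simp only [evalLetter, cond_true, cond_false, inv_inv]
    exacts [(hz i).symm, hz i]
  by_cases hz1 : ∃ i, z i ≠ 1
  · obtain ⟨w, hw⟩ := hs.2 z hz1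
    exact hw.hasHamiltonianCycle three_le fun x hx => by
      obtain ⟨y, -, rfl⟩ := List.mem_map.1 hx
      exact letter_mem y
  · push Not at hz1
    have := Finite.one_lt_card_iff_nontrivial.1 hC.out.one_lt
    obtain ⟨⟨a, c⟩, hac, hc⟩ := exists_snd_ne_one_of_closure_eq_top hS
    obtain ⟨v, hv, hmem⟩ := hw₀.exists_isHamiltonianWord_prod hA a
      (orderOf_eq_card_of_prime_card hc) hcard
    refine hv.hasHamiltonianCycle three_le fun x hx => ?_
    have evalLetter_eq (y : ι × Bool) :
        evalLetter (fun i => (s i, z i)) y = (evalLetter s y, 1) := by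
      rcases y with ⟨i, _ | _⟩ <;> simp [evalLetter, hz1]
    have mem_of_mem {g : A} (hg : g ∈ w₀.map (evalLetter s)) :
        (g, (1 : C)) ∈ S ∨ (g, (1 : C))⁻¹ ∈ S := by
      obtain ⟨y, -, rfl⟩ := List.mem_map.1 hg
      exact evalLetter_eq y ▸ letter_mem y
    obtain ⟨g, d⟩ := x
    obtain hx | ⟨hg | hg, rfl⟩ := hmem _ hx
    · exact Or.inl (hx ▸ hac)
    · exact mem_of_mem hg
    · simpa only [Prod.inv_mk, inv_inv, inv_one, or_comm] using mem_of_mem hg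

end Lifts

section Certificates

open Equiv

/-- The preimages of `0, …, n - 1` under a permutation, read as the digits of a number. Comparing
these numbers is much cheaper for the kernel than comparing permutations, and preimages under
consecutive vertices of a walk share subterms that images do not share. -/
def permKey {n : ℕ} (g : Perm (Fin n)) : ℕ := Nat.ofDigits n (List.ofFn fun i => (g.symm i : ℕ))

theorem permKey_injective {n : ℕ} : Function.Injective (permKey (n := n)) := by
  intro g h hgh
  rcases n with _ | _ | n
  · exact Subsingleton.elim g h
  · exact Subsingleton.elim (α := Perm (Fin 1)) g h
  · have lt_of_mem (k : Perm (Fin (n + 2))) :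
        ∀ d ∈ List.ofFn fun i => (k.symm i : ℕ), d < n + 2 := by
      simp [List.mem_ofFn]
    have hdigits := Nat.ofDigits_inj_of_len_eq (by lia) (by simp) (lt_of_mem g) (lt_of_mem h) hgh
    rw [List.ofFn_inj] at hdigits
    exact Equiv.symm_bijective.injective (Equiv.ext fun i => Fin.ext (congrFun hdigits i))

/-- Generators of the alternating group of degree `5`, and for each of them a hamiltonian word,
given by the block of which it is a power. The determinant of the exponent sums of these words is
meant to be small and nonzero. -/
structure HamiltonianCertificate where
  n : ℕ
  [neZero_n : NeZero n]
  gens : Fin n → Perm (Fin 5)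
  blocks : Fin n → Word (Fin n)

attribute [instance] HamiltonianCertificate.neZero_n

/-- The hamiltonian word of length `60` with a given block. -/
def HamiltonianCertificate.word (e : HamiltonianCertificate) (k : Fin e.n) : Word (Fin e.n) :=
  (List.replicate (60 / (e.blocks k).length) (e.blocks k)).flatten

namespace Letter

variable {n : ℕ} [NeZero n]

/-- The letters `a`, `b`, `c` stand for the generators `0`, `1`, `2`, and the capitals `A`, `B`, `C`
for their inverses. -/
abbrev a : Fin n × Bool := (0, true)

abbrev b : Fin n × Bool := (1, true)
abbrev c : Fin n × Bool := (2, true)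
abbrev A : Fin n × Bool := (0, false)
abbrev B : Fin n × Bool := (1, false)
abbrev C : Fin n × Bool := (2, false)

end Letter

open Letter in
/-- Certificates for generating tuples that contain a `5`-cycle. -/
def fiveCycleCertificates : List HamiltonianCertificate := [
  ⟨2, ![c[0, 1, 2, 3, 4], c[0, 1, 2]],
    ![[B, A, b, b, A, b, b, a, B, a, a, B],
        [B, a, a, B, B, A, B, B, a, B, B, A]]⟩,
  ⟨2, ![c[0, 1, 2, 3, 4], c[0, 1, 3]],
    ![[A, A, B, A, b, A, A, A, A, b, a, a, a, a, B, A, A, B, A, A],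
        [A, B, B, A, B, a, B, B, a, B, B, a, B, B, A, b, b, a, a, B, B, a, a, b, b, A, b, a, a, b,
       A, b, b, a, B, B, a, B, B, a, B, B, a, a, b, a, a, B, A, A, b, A, A, A, b, A, B, A, A, A]]⟩,
  ⟨2, ![c[0, 1, 2, 3, 4], c[0, 1] * c[2, 3]],
    ![[A, B, A, A, b, a, a, B, a, a, a, a, b, A, B, a, B, A, A, A],
        [B, a, b, a, B, A, b, a, a, a, a, B, a, a, B, a, B, a, a, a, a, B, a, B, a, a, a, a, b, a,
       a, b, A, b, a, a, a, a, b, a, B, a, a, b, a, a, b, a, a, b, A, A, B, a, a, a, a, B, A, A]]⟩,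
  ⟨2, ![c[0, 1, 2, 3, 4], c[0, 2] * c[1, 3]],
    ![[b, a, a, B, A, A, b, A, B, a, a, b, A, B, a, b, A, A, b, a],
        [b, a, B, A, B, a, B, a, a, a, a, B, a, a, B, a, a, a, a, B, A, A, B, a, a, a, a, b, A, A,
       B, a, a, a, a, b, A, b, a, b, a, a, a, a, b, a, a, b, a, a, a, a, B, A, A, B, A, A, A, A]]⟩,
  ⟨2, ![c[0, 1, 2, 3, 4], c[0, 1, 2, 4, 3]],
    ![[b, A, b, a, B, B, a, B, a, a, B, A, b, A, B, A, A, b, b, b],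
        [a, b, A, B, A, b, A, b, A, A, B, a, a, B, B, A, B, a, b, a]]⟩,
  ⟨2, ![c[0, 1, 2, 3, 4], c[0, 1, 3, 4, 2]],
    ![[a, b, a, B, A, A, A, A, b, b, a, B, a, a, B, A, A, B, a, a],
        [A, B, a, b, b, a, b, b, b, a, a, B, B, A, A, B, A, B, B, A]]⟩]

open Letter in
/-- Certificates for generating tuples that contain a `3`-cycle and no `5`-cycle. -/
def threeCycleCertificates : List HamiltonianCertificate := [
  ⟨2, ![c[0, 1, 2], c[0, 3, 4]],
    ![[A, B, B, a, B, B, a, a, b, A, b, b],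
        [B, B, a, b, a, a, b, A, A, B, A, A]]⟩,
  ⟨3, ![c[0, 1, 2], c[0, 1] * c[2, 3], c[0, 1] * c[3, 4]],
    ![[A, b, a, b, A, A, C, B, a, a, c, A],
        [B, a, a, b, C, B, c, b, A, A, B, C],
        [B, a, a, B, c, B, c, b, A, A, b, C]]⟩,
  ⟨3, ![c[0, 1, 2], c[0, 1] * c[2, 3], c[0, 2] * c[3, 4]],
    ![[A, A, c, A, b, a, a, C, a, a, B, C],
        [a, C, b, c, B, a, c, B, A, B, A, b],
        [a, c, b, C, B, a, c, B, A, b, A, b]]⟩,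
  ⟨3, ![c[0, 1, 2], c[0, 1] * c[2, 3], c[0, 1] * c[2, 4]],
    ![[c, b, c, b, C, a, C, A, c, B, C, a],
        [A, B, A, c, b, a, C, B, c, a, a, C],
        [c, A, A, B, a, a, C, a, a, C, A, A]]⟩,
  ⟨3, ![c[0, 1, 2], c[0, 1, 3], c[0, 1] * c[2, 4]],
    ![[A, C, A, b, c, b, a, a, B, B, a, B],
        [C, B, B, A, A, b, b, c, B, B, a, b],
        [a, a, c, a, a, c, A, A, C, A, A, b]]⟩,
  ⟨3, ![c[0, 1, 2], c[0, 1] * c[2, 3], c[0, 2] * c[1, 4]],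
    ![[a, B, C, a, c, A, A, b, A, B, c, a],
        [a, b, c, a, C, A, A, b, A, B, c, a],
        [a, c, A, A, B, a, a, b, C, A, A, B]]⟩,
  ⟨3, ![c[0, 1, 2], c[0, 1, 3], c[0, 1, 4]],
    ![[A, c, c, A, A, C, a, C, C, a, B, c],
        [c, b, b, a, B, A, A, B, B, C, b, c],
        [c, c, a, c, B, B, a, b, C, b, C, A]]⟩]

open Letter in
/-- Certificates for generating triples of involutions. -/
def involutionCertificates : List HamiltonianCertificate := [
  ⟨3, ![c[0, 1] * c[2, 3], c[0, 1] * c[2, 4], c[0, 2] * c[1, 3]],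
    ![[C, B, a, b, A, B, C, B, a, c, A, b],
        [c, A, B, C, B, a, b, a, B, c, b, A],
        [C, B, A, b, a, B, c, b, a, C, a, B]]⟩,
  ⟨3, ![c[0, 1] * c[2, 3], c[0, 2] * c[1, 3], c[0, 3] * c[1, 4]],
    ![[a, C, B, A, B, C, a, c, a, b, A, c],
        [a, c, B, a, b, c, A, C, A, b, a, C],
        [c, b, C, B, a, b, C, B, C, a, c, A]]⟩,
  ⟨3, ![c[0, 1] * c[2, 3], c[0, 1] * c[2, 4], c[0, 3] * c[2, 4]],
    ![[b, a, b, A, C, b, a, B, a, B, c, A],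
        [c, a, B, a, b, A, C, b, A, B, A, b],
        [b, a, c, B, A, B, a, b, c, A, B, C]]⟩,
  ⟨3, ![c[0, 1] * c[2, 3], c[0, 1] * c[2, 4], c[0, 2] * c[3, 4]],
    ![[C, A, C, a, C, B, C, b, C, b, c, b, c, a, c, B, c, B, c, B],
        [c, B, C, b, c, b, C, b, C, a, B, C, B, c, b, c, B, C, b, A],
        [c, B, C, B, c, A, c, b, c, B, C, b, c, b, C, a, C, a, C, b]]⟩,
  ⟨3, ![c[0, 1] * c[2, 3], c[0, 1] * c[2, 4], c[0, 3] * c[1, 4]],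
    ![[A, B, C, A, C, b, A, c, b, a, C, a, c, B, C, a, c, A, B, c],
        [a, b, C, A, B, c, a, C, B, A, C, b, A, c, a, c, B, C, a, c],
        [a, c, A, C, B, C, A, c, A, C, a, c, A, C, b, C, a, c, B, C]]⟩,
  ⟨3, ![c[0, 1] * c[2, 3], c[0, 2] * c[1, 4], c[1, 3] * c[2, 4]],
    ![[a, B, a, c, b, C, b, A, c, b, a, c, A, B, C, b, C, A, B, c],
        [a, C, B, a, c, a, C, B, A, b, c, A, b, C, A, c, a, b, C, B],
        [c, B, A, B, a, C, B, C, a, B, C, A, b, A, b, c, a, c, b, a]]⟩]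

/-- Together with `exceptionalPair`, these certificates take care of every generating set of the
alternating group of degree `5`. -/
def certificates : List HamiltonianCertificate :=
  fiveCycleCertificates ++ threeCycleCertificates ++ involutionCertificates

theorem isHamiltonianWord_certificates :
    ∀ e ∈ certificates, ∀ k, (e.word k).length = 60 ∧
      ((e.word k).map (evalLetter e.gens)).prod = 1 ∧
      ((walkVertices 1 ((e.word k).map (evalLetter e.gens))).map permKey).Nodup := by
  decide +kernel

theorem det_exponent_certificates :
    ∀ e ∈ certificates,
      (Matrix.of fun k i => exponent i (e.word k)).det.natAbs ∈ Finset.Icc 1 500 := by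
  decide +kernel

end Certificates

section ExceptionalPair

open Equiv

/-- A generating pair of the alternating group of degree `5` that is treated without a certificate:
its lifts that are trivial on the involution come from `isHamiltonianWord_stretch`. -/
def exceptionalPair : Fin 2 → Perm (Fin 5) := ![c[1, 2] * c[3, 4], c[0, 1, 3]]

open Letter in
/-- A hamiltonian word in `exceptionalPair` in which the involution has exponent sum `20`. -/
def exceptionalWord : Word (Fin 2) :=
  (List.replicate 2
    [b, b, a, B, B, a, b, b, a, b, b, a, b, b, a, B, B, a, B, B, a, B, B, a, b, b, a, B,
     B, a]).flatten

open Letter in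
/-- A hamiltonian word on four copies of the alternating group of degree `5`, to be stretched. -/
def exceptionalLayeredWord : Word (Fin 2) :=
  (List.replicate 5
    [a, B, a, b, b, a, b, a, b, b, a, B, B, a, B, a, B, B, a, b, a, B, B, a, B, a, b, b,
     b, b, b, b, b, b, a, B, B, B, B, B, B, B, B, a, b, a, b, b]).flatten

theorem isHamiltonianWord_exceptionalWord :
    exceptionalWord.length = 60 ∧
      (exceptionalWord.map (evalLetter exceptionalPair)).prod = 1 ∧
      ((walkVertices 1 (exceptionalWord.map (evalLetter exceptionalPair))).map permKey).Nodup := by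
  decide +kernel

theorem exponent_exceptionalWord :
    exponent 0 exceptionalWord = 20 ∧ exponent 1 exceptionalWord = 0 := by
  decide +kernel

theorem isHamiltonianWord_exceptionalLayeredWord :
    let w := exceptionalLayeredWord.map
      (evalLetter (layerGenerators (exceptionalPair 0) (exceptionalPair 1)))
    w.length = 240 ∧ w.prod = 1 ∧
      ((walkVertices 1 w).map fun x => 4 * permKey x.1 + (Multiplicative.toAdd x.2).val).Nodup := by
  decide +kernel

theorem crossings_exceptionalLayeredWord :
    let l := crossings (exceptionalPair 0) (exceptionalPair 1) 1 exceptionalLayeredWord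
    l.length = 60 ∧ (l.map permKey).Nodup := by
  decide +kernel

theorem not_isSolvable_alternatingGroup_five : ¬ Group.IsSolvable (alternatingGroup (Fin 5)) := by
  intro h
  exact Perm.not_isSolvable_fin_5 <|
    Group.isSolvable_of_ker_le_range (alternatingGroup (Fin 5)).subtype Perm.sign
      (by rw [Subgroup.range_subtype]; rfl)

theorem nat_card_alternatingGroup_five : Nat.card (alternatingGroup (Fin 5)) = 60 := by
  rw [nat_card_alternatingGroup, Nat.card_fin]
  rfl

variable {ι C : Type*} [CommGroup C]

theorem map_subtype_map_evalLetter (s : ι → alternatingGroup (Fin 5)) (w : Word ι) :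
    (w.map (evalLetter s)).map (alternatingGroup (Fin 5)).subtype =
      w.map (evalLetter fun i => (s i : Perm (Fin 5))) := by
  rw [List.map_map]
  exact List.map_congr_left fun x _ => map_evalLetter (alternatingGroup (Fin 5)).subtype s x

theorem isHamiltonianWord_of_nodup_permKey {s : ι → alternatingGroup (Fin 5)} {w : Word ι}
    (hlength : w.length = 60)
    (hprod : (w.map (evalLetter fun i => (s i : Perm (Fin 5)))).prod = 1)
    (hnodup : ((walkVertices 1 (w.map (evalLetter fun i => (s i : Perm (Fin 5))))).map
      permKey).Nodup) :
    IsHamiltonianWord (w.map (evalLetter s)) := by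
  rw [← map_subtype_map_evalLetter] at hprod hnodup
  refine IsHamiltonianWord.of_nodup_map (Subgroup.subtype_injective _) ?_ hprod hnodup.of_map
  rw [List.length_map, hlength, nat_card_alternatingGroup_five]

theorem HasHamiltonianLifts.of_conj {t : ι → Perm (Fin 5)} {s : ι → alternatingGroup (Fin 5)}
    {σ : Perm (Fin 5)}
    (ht : ∀ r : ι → alternatingGroup (Fin 5), (∀ i, (r i : Perm (Fin 5)) = t i) →
      HasHamiltonianLifts C r)
    (hs : ∀ i, (s i : Perm (Fin 5)) = σ * t i * σ⁻¹) : HasHamiltonianLifts C s := by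
  have hr := ht (fun i => (MulAut.conjNormal σ).symm (s i)) fun i => by
    rw [MulAut.conjNormal_symm_apply, hs]
    group
  simpa only [MulEquiv.apply_symm_apply] using hr.map (MulAut.conjNormal σ)

theorem not_dvd_of_natAbs_mem_Icc {p n : ℕ} {d : ℤ} (hn : n < p)
    (hd : d.natAbs ∈ Finset.Icc 1 n) : ¬ (p : ℤ) ∣ d := by
  rw [Int.natCast_dvd]
  rw [Finset.mem_Icc] at hd
  exact Nat.not_dvd_of_pos_of_lt hd.1 (hd.2.trans_lt hn)

theorem HamiltonianCertificate.hasHamiltonianLifts [Fact (Nat.card C).Prime]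
    (hcard : 500 < Nat.card C) {e : HamiltonianCertificate} (he : e ∈ certificates)
    {s : Fin e.n → alternatingGroup (Fin 5)} (hs : ∀ i, (s i : Perm (Fin 5)) = e.gens i) :
    HasHamiltonianLifts C s := by
  have hgens : (fun i => (s i : Perm (Fin 5))) = e.gens := funext hs
  refine hasHamiltonianLifts_of_det (w := e.word) (fun k => ?_)
    (not_dvd_of_natAbs_mem_Icc hcard (det_exponent_certificates e he))
  obtain ⟨hlength, hprod, hnodup⟩ := isHamiltonianWord_certificates e he k
  rw [← hgens] at hprod hnodup
  exact isHamiltonianWord_of_nodup_permKey hlength hprod hnodup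

variable {s : Fin 2 → alternatingGroup (Fin 5)}

theorem isHamiltonianWord_layered (hs : ∀ i, (s i : Perm (Fin 5)) = exceptionalPair i) :
    IsHamiltonianWord
      (exceptionalLayeredWord.map (evalLetter (layerGenerators (s 0) (s 1)))) := by
  let f := (alternatingGroup (Fin 5)).subtype.prodMap (MonoidHom.id (Multiplicative (ZMod 4)))
  have hf : Function.Injective f :=
    Function.Injective.prodMap (Subgroup.subtype_injective _) Function.injective_id
  have hmap : (exceptionalLayeredWord.map (evalLetter (layerGenerators (s 0) (s 1)))).map f =
      exceptionalLayeredWord.map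
        (evalLetter (layerGenerators (exceptionalPair 0) (exceptionalPair 1))) := by
    rw [List.map_map]
    refine List.map_congr_left fun x _ => (map_evalLetter f _ x).trans ?_
    congr 1
    funext i
    fin_cases i
    exacts [Prod.ext (hs 0) rfl, Prod.ext (hs 1) rfl]
  obtain ⟨hlength, hprod, hnodup⟩ := isHamiltonianWord_exceptionalLayeredWord
  rw [← hmap] at hprod hnodup
  refine IsHamiltonianWord.of_nodup_map hf ?_ hprod hnodup.of_map
  rw [← hmap, List.length_map] at hlength
  rw [hlength, Nat.card_prod, nat_card_alternatingGroup_five]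
  simp

theorem mem_crossings_layered (hs : ∀ i, (s i : Perm (Fin 5)) = exceptionalPair i) :
    (crossings (s 0) (s 1) 1 exceptionalLayeredWord).length = Nat.card (alternatingGroup (Fin 5)) ∧
      ∀ g, g ∈ crossings (s 0) (s 1) 1 exceptionalLayeredWord := by
  obtain ⟨hlength, hnodup⟩ := crossings_exceptionalLayeredWord
  have hmap := crossings_map (a := s 0) (b := s 1) (alternatingGroup (Fin 5)).subtype 1
    exceptionalLayeredWord
  simp only [Subgroup.subtype_apply, hs, Prod.fst_one, Prod.snd_one, map_one] at hmap
  rw [Prod.one_eq_mk, hmap] at hlength hnodup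
  rw [List.length_map, ← nat_card_alternatingGroup_five] at hlength
  exact ⟨hlength, mem_of_nodup_of_length_eq_card hnodup.of_map.of_map hlength⟩

theorem hasHamiltonianLifts_exceptionalPair [hC : Fact (Nat.card C).Prime]
    (hcard : 20 < Nat.card C) {m : ℕ} (hm : Nat.card C = 3 * m + 4)
    (hs : ∀ i, (s i : Perm (Fin 5)) = exceptionalPair i) : HasHamiltonianLifts C s := by
  have hgens : (fun i => (s i : Perm (Fin 5))) = exceptionalPair := funext hs
  obtain ⟨hlength, hprod, hnodup⟩ := isHamiltonianWord_exceptionalWord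
  rw [← hgens] at hprod hnodup
  have hw := isHamiltonianWord_of_nodup_permKey hlength hprod hnodup
  refine ⟨⟨_, hw⟩, fun z hz => ?_⟩
  by_cases hz0 : z 0 = 1
  · have := Nat.finite_of_card_ne_zero hC.out.ne_zero
    have hz1 : z 1 ≠ 1 := by simpa [Fin.exists_fin_two, hz0] using hz
    have cube_eq_one : s 1 ^ 3 = 1 := Subtype.ext <| by
      rw [Subgroup.coe_pow, hs]
      decide
    have hpair : (fun i => (s i, z i)) = ![(s 0, 1), (s 1, z 1)] := by
      funext i
      fin_cases i
      exacts [Prod.ext rfl hz0, rfl]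
    rw [hpair]
    obtain ⟨hcrossings_length, hcrossings⟩ := mem_crossings_layered hs
    exact ⟨_, isHamiltonianWord_stretch cube_eq_one (orderOf_eq_card_of_prime_card hz1) hm
      (isHamiltonianWord_layered hs) hcrossings_length hcrossings⟩
  · refine hw.exists_lift fun h => ?_
    rw [Fin.prod_univ_two, exponent_exceptionalWord.1, exponent_exceptionalWord.2, zpow_zero,
      mul_one, ← orderOf_dvd_iff_zpow_eq_one, orderOf_eq_card_of_prime_card hz0] at h
    exact not_dvd_of_natAbs_mem_Icc hcard (by decide) h

end ExceptionalPair

section Classification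

open Equiv

/-- The entries of a list of permutations and their inverses. Membership is decided through
`permKey` for the sake of the exhaustive searches below. -/
def inverseClosure (T : List (Perm (Fin 5))) : Set (Perm (Fin 5)) :=
  {g | permKey g ∈ (T ++ T.map (·⁻¹)).map permKey}

instance (T : List (Perm (Fin 5))) : DecidablePred (· ∈ inverseClosure T) := fun g =>
  inferInstanceAs (Decidable (permKey g ∈ (T ++ T.map (·⁻¹)).map permKey))

/-- Some simultaneous conjugate of the tuple `s` has all its entries in `F`. -/
def ContainsConjugate {ι : Type*} (F : Set (Perm (Fin 5))) (s : ι → Perm (Fin 5)) : Prop :=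
  ∃ σ : Perm (Fin 5), ∀ i, σ * s i * σ⁻¹ ∈ F

instance {n : ℕ} (F : Set (Perm (Fin 5))) [DecidablePred (· ∈ F)] (s : Fin n → Perm (Fin 5)) :
    Decidable (ContainsConjugate F s) :=
  inferInstanceAs (Decidable (∃ _, _))

/-- Up to conjugation, `F` contains a tuple for which `HasHamiltonianLifts` has been verified. -/
def ContainsCatalogued (F : Set (Perm (Fin 5))) : Prop :=
  ContainsConjugate F exceptionalPair ∨ ∃ e ∈ certificates, ContainsConjugate F e.gens

/-- The extended centralizer of `x`: the elements that conjugate `x` to `x` or to `x⁻¹`. -/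
def extendedCentralizer {G : Type*} [Group G] (x : G) : Subgroup G where
  carrier := {y | y * x * y⁻¹ = x ∨ y * x * y⁻¹ = x⁻¹}
  one_mem' := by simp
  mul_mem' {y z} hy hz := by
    have hmul (t : G) : y * z * t * (y * z)⁻¹ = y * (z * t * z⁻¹) * y⁻¹ := by group
    have hinv : y * x⁻¹ * y⁻¹ = (y * x * y⁻¹)⁻¹ := by group
    simp only [Set.mem_ofPred_eq, hmul]
    rcases hy with hy | hy <;> rcases hz with hz | hz <;> simp [hy, hz, hinv]
  inv_mem' {y} hy := by
    rcases hy with hy | hy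
    · exact Or.inl <| calc
        y⁻¹ * x * y⁻¹⁻¹ = y⁻¹ * (y * x * y⁻¹) * y := by rw [hy, inv_inv]
        _ = x := by group
    · exact Or.inr <| calc
        y⁻¹ * x * y⁻¹⁻¹ = y⁻¹ * (y * x * y⁻¹)⁻¹ * y := by rw [hy, inv_inv, inv_inv]
        _ = x⁻¹ := by group

instance (x : Perm (Fin 5)) : DecidablePred (· ∈ extendedCentralizer x) := fun y =>
  inferInstanceAs (Decidable (y * x * y⁻¹ = x ∨ y * x * y⁻¹ = x⁻¹))

theorem exists_sign_eq_one_notMem_extendedCentralizer :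
    ∀ x : Perm (Fin 5), x ≠ 1 → ∃ y, Perm.sign y = 1 ∧ y ∉ extendedCentralizer x := by
  decide +kernel

theorem exists_sign_eq_one_apply_ne :
    ∀ i : Fin 5, ∃ y : Perm (Fin 5), Perm.sign y = 1 ∧ y i ≠ i := by
  decide +kernel

theorem containsConjugate_of_pow_six_ne_one :
    ∀ x, Perm.sign x = 1 → x ^ 6 ≠ 1 →
      ContainsConjugate (inverseClosure [x]) ![c[0, 1, 2, 3, 4]] := by
  decide +kernel

theorem containsConjugate_of_sq_ne_one :
    ∀ x, Perm.sign x = 1 → x ^ 6 = 1 → x ^ 2 ≠ 1 →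
      ContainsConjugate (inverseClosure [x]) ![c[0, 1, 2]] := by
  decide +kernel

theorem containsConjugate_of_sq_eq_one :
    ∀ x, Perm.sign x = 1 → x ^ 2 = 1 → x ≠ 1 →
      ContainsConjugate (inverseClosure [x]) ![c[0, 1] * c[2, 3]] := by
  decide +kernel

theorem containsConjugate_fiveCycle :
    ∀ y, Perm.sign y = 1 → y ∉ extendedCentralizer c[0, 1, 2, 3, 4] →
      ∃ e ∈ fiveCycleCertificates,
        ContainsConjugate (inverseClosure [c[0, 1, 2, 3, 4], y]) e.gens := by
  decide +kernel

theorem containsConjugate_threeCycle :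
    ∀ y, Perm.sign y = 1 → y ^ 6 = 1 → y ∉ extendedCentralizer c[0, 1, 2] →
      ContainsConjugate (inverseClosure [c[0, 1, 2], y]) exceptionalPair ∨
      (∃ t ∈ [c[0, 1, 3], c[0, 1] * c[2, 3]],
        ContainsConjugate (inverseClosure [c[0, 1, 2], y]) ![c[0, 1, 2], t]) ∨
      ∃ e ∈ threeCycleCertificates,
        ContainsConjugate (inverseClosure [c[0, 1, 2], y]) e.gens := by
  decide +kernel

theorem containsConjugate_threeCycle_pair :
    ∀ t ∈ [c[0, 1, 3], c[0, 1] * c[2, 3]], ∀ y, Perm.sign y = 1 → y ^ 6 = 1 → y 4 ≠ 4 →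
      ContainsConjugate (inverseClosure [c[0, 1, 2], t, y]) exceptionalPair ∨
      ∃ e ∈ threeCycleCertificates,
        ContainsConjugate (inverseClosure [c[0, 1, 2], t, y]) e.gens := by
  decide +kernel

theorem containsConjugate_involution :
    ∀ y, Perm.sign y = 1 → y ^ 2 = 1 → y ∉ extendedCentralizer (c[0, 1] * c[2, 3]) →
      ∃ t ∈ [c[0, 1] * c[2, 4], c[1, 2] * c[3, 4]],
        ContainsConjugate (inverseClosure [c[0, 1] * c[2, 3], y]) ![c[0, 1] * c[2, 3], t] := by
  decide +kernel

theorem containsConjugate_involution_pair :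
    ∀ t ∈ [c[0, 1] * c[2, 4], c[1, 2] * c[3, 4]],
      ∀ y, Perm.sign y = 1 → y ^ 2 = 1 → y ∉ extendedCentralizer (c[0, 1] * c[2, 3] * t) →
        ∃ e ∈ involutionCertificates,
          ContainsConjugate (inverseClosure [c[0, 1] * c[2, 3], t, y]) e.gens := by
  decide +kernel

theorem inverseClosure_subset {F : Set (Perm (Fin 5))} (hF : ∀ y ∈ F, y⁻¹ ∈ F)
    {T : List (Perm (Fin 5))} (hT : ∀ t ∈ T, t ∈ F) : inverseClosure T ⊆ F := by
  intro g hg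
  obtain ⟨t, ht, htg⟩ := List.mem_map.1 hg
  obtain rfl := permKey_injective htg
  rcases List.mem_append.1 ht with ht | ht
  · exact hT t ht
  · obtain ⟨r, hr, rfl⟩ := List.mem_map.1 ht
    exact hF r (hT r hr)

theorem ContainsConjugate.mono {ι : Type*} {F F' : Set (Perm (Fin 5))} {s : ι → Perm (Fin 5)}
    (h : ContainsConjugate F s) (hF : F ⊆ F') : ContainsConjugate F' s :=
  h.imp fun _ hσ i => hF (hσ i)

theorem ContainsConjugate.of_inv_smul {ι : Type*} {F : Set (Perm (Fin 5))}
    {s : ι → Perm (Fin 5)} {σ : Perm (Fin 5)}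
    (h : ContainsConjugate ((MulAut.conj σ)⁻¹ • F) s) : ContainsConjugate F s := by
  obtain ⟨τ, hτ⟩ := h
  refine ⟨σ * τ, fun i => ?_⟩
  have := Set.mem_inv_smul_set_iff.1 (hτ i)
  rwa [MulAut.smul_def, MulAut.conj_apply,
    show σ * (τ * s i * τ⁻¹) * σ⁻¹ = σ * τ * s i * (σ * τ)⁻¹ by group] at this

theorem containsCatalogued_of_subset {F F' : Set (Perm (Fin 5))} {L : List HamiltonianCertificate}
    (hF : F ⊆ F') (hL : L ⊆ certificates) (h : ∃ e ∈ L, ContainsConjugate F e.gens) :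
    ContainsCatalogued F' := by
  obtain ⟨e, he, h⟩ := h
  exact Or.inr ⟨e, hL he, h.mono hF⟩

/-- A symmetric generating set of the alternating group of degree `5` whose elements have order
dividing `n`; this last condition is void for `n = 0`. -/
structure IsSymmetricGenerating (n : ℕ) (F : Set (Perm (Fin 5))) : Prop where
  inv_mem : ∀ y ∈ F, y⁻¹ ∈ F
  closure_eq : Subgroup.closure F = alternatingGroup (Fin 5)
  pow_eq_one : ∀ y ∈ F, y ^ n = 1

namespace IsSymmetricGenerating

variable {n : ℕ} {F : Set (Perm (Fin 5))}

theorem sign_eq_one (hF : IsSymmetricGenerating n F) {y : Perm (Fin 5)} (hy : y ∈ F) :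
    Perm.sign y = 1 :=
  Perm.mem_alternatingGroup.1 (hF.closure_eq ▸ Subgroup.subset_closure hy)

theorem exists_notMem (hF : IsSymmetricGenerating n F) {H : Subgroup (Perm (Fin 5))}
    (hH : ∃ y, Perm.sign y = 1 ∧ y ∉ H) : ∃ y ∈ F, y ∉ H := by
  obtain ⟨y, hsign, hy⟩ := hH
  by_contra! h
  refine hy ((Subgroup.closure_le H).2 h ?_)
  rw [hF.closure_eq]
  exact Perm.mem_alternatingGroup.2 hsign

theorem exists_notMem_extendedCentralizer (hF : IsSymmetricGenerating n F) {x : Perm (Fin 5)}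
    (hx : x ≠ 1) : ∃ y ∈ F, y ∉ extendedCentralizer x :=
  hF.exists_notMem (exists_sign_eq_one_notMem_extendedCentralizer x hx)

theorem exists_apply_ne (hF : IsSymmetricGenerating n F) (i : Fin 5) : ∃ y ∈ F, y i ≠ i :=
  hF.exists_notMem (H := MulAction.stabilizer (Perm (Fin 5)) i) (exists_sign_eq_one_apply_ne i)

theorem exists_ne_one (hF : IsSymmetricGenerating n F) : ∃ y ∈ F, y ≠ 1 :=
  (hF.exists_apply_ne 0).imp fun _ ⟨hy, hne⟩ => ⟨hy, fun h => hne (h ▸ rfl)⟩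

theorem inv_smul (hF : IsSymmetricGenerating n F) (σ : Perm (Fin 5)) :
    IsSymmetricGenerating n ((MulAut.conj σ)⁻¹ • F) where
  inv_mem y hy := by
    rw [Set.mem_inv_smul_set_iff] at hy ⊢
    rw [smul_inv']
    exact hF.inv_mem _ hy
  closure_eq := by rw [← Subgroup.smul_closure, hF.closure_eq, ← map_inv,
    Subgroup.Normal.conj_smul_eq_self]
  pow_eq_one y hy := by
    have h := hF.pow_eq_one _ (Set.mem_inv_smul_set_iff.1 hy)
    rw [← smul_pow'] at h
    exact smul_left_cancel (MulAut.conj σ) (h.trans (smul_one _).symm)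

theorem containsCatalogued_of_containsConjugate {ι : Type*} {s : ι → Perm (Fin 5)}
    (hF : IsSymmetricGenerating n F) (hs : ContainsConjugate F s)
    (h : ∀ F', IsSymmetricGenerating n F' → (∀ i, s i ∈ F') → ContainsCatalogued F') :
    ContainsCatalogued F := by
  obtain ⟨σ, hσ⟩ := hs
  refine (h _ (hF.inv_smul σ) fun i => Set.mem_inv_smul_set_iff.2 (hσ i)).imp
    ContainsConjugate.of_inv_smul ?_
  rintro ⟨e, he, hconj⟩
  exact ⟨e, he, hconj.of_inv_smul⟩

theorem containsCatalogued_of_fiveCycle (hF : IsSymmetricGenerating n F)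
    (hs : c[0, 1, 2, 3, 4] ∈ F) : ContainsCatalogued F := by
  obtain ⟨y, hy, hne⟩ := hF.exists_notMem_extendedCentralizer
    (x := c[0, 1, 2, 3, 4]) (by decide)
  exact containsCatalogued_of_subset (inverseClosure_subset hF.inv_mem (by simp [hs, hy]))
    (by simp [certificates]) (containsConjugate_fiveCycle y (hF.sign_eq_one hy) hne)

theorem containsCatalogued_of_threeCycle_pair (hF : IsSymmetricGenerating 6 F)
    {t : Perm (Fin 5)} (ht : t ∈ [c[0, 1, 3], c[0, 1] * c[2, 3]])
    (hs : ∀ i, ![c[0, 1, 2], t] i ∈ F) : ContainsCatalogued F := by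
  obtain ⟨y, hy, hne⟩ := hF.exists_apply_ne 4
  have hsub : inverseClosure [c[0, 1, 2], t, y] ⊆ F :=
    inverseClosure_subset hF.inv_mem (by simpa [Fin.forall_fin_two, hy] using hs)
  rcases containsConjugate_threeCycle_pair t ht y (hF.sign_eq_one hy) (hF.pow_eq_one y hy) hne with
    h | h
  · exact Or.inl (h.mono hsub)
  · exact containsCatalogued_of_subset hsub (by simp [certificates]) h

theorem containsCatalogued_of_threeCycle (hF : IsSymmetricGenerating 6 F)
    (hs : c[0, 1, 2] ∈ F) : ContainsCatalogued F := by
  obtain ⟨y, hy, hne⟩ := hF.exists_notMem_extendedCentralizer (x := c[0, 1, 2]) (by decide)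
  have hsub : inverseClosure [c[0, 1, 2], y] ⊆ F :=
    inverseClosure_subset hF.inv_mem (by simp [hs, hy])
  rcases containsConjugate_threeCycle y (hF.sign_eq_one hy) (hF.pow_eq_one y hy) hne with
    h | ⟨t, ht, h⟩ | h
  · exact Or.inl (h.mono hsub)
  · exact hF.containsCatalogued_of_containsConjugate (h.mono hsub) fun F' hF' hs' =>
      hF'.containsCatalogued_of_threeCycle_pair ht hs'
  · exact containsCatalogued_of_subset hsub (by simp [certificates]) h

theorem containsCatalogued_of_involution_pair (hF : IsSymmetricGenerating 2 F)
    {t : Perm (Fin 5)} (ht : t ∈ [c[0, 1] * c[2, 4], c[1, 2] * c[3, 4]])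
    (hs : ∀ i, ![c[0, 1] * c[2, 3], t] i ∈ F) : ContainsCatalogued F := by
  have hne_one : ∀ t ∈ [c[0, 1] * c[2, 4], c[1, 2] * c[3, 4]],
      (c[0, 1] * c[2, 3] * t : Perm (Fin 5)) ≠ 1 := by
    decide +kernel
  obtain ⟨y, hy, hne⟩ := hF.exists_notMem_extendedCentralizer (hne_one t ht)
  exact containsCatalogued_of_subset
    (inverseClosure_subset hF.inv_mem (by simpa [Fin.forall_fin_two, hy] using hs))
    (by simp [certificates])
    (containsConjugate_involution_pair t ht y (hF.sign_eq_one hy) (hF.pow_eq_one y hy) hne)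

theorem containsCatalogued_of_involution (hF : IsSymmetricGenerating 2 F)
    (hs : c[0, 1] * c[2, 3] ∈ F) : ContainsCatalogued F := by
  obtain ⟨y, hy, hne⟩ := hF.exists_notMem_extendedCentralizer
    (x := c[0, 1] * c[2, 3]) (by decide)
  obtain ⟨t, ht, h⟩ :=
    containsConjugate_involution y (hF.sign_eq_one hy) (hF.pow_eq_one y hy) hne
  exact hF.containsCatalogued_of_containsConjugate
    (h.mono (inverseClosure_subset hF.inv_mem (by simp [hs, hy]))) fun F' hF' hs' =>
      hF'.containsCatalogued_of_involution_pair ht hs'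

theorem containsCatalogued (hF : IsSymmetricGenerating 0 F) : ContainsCatalogued F := by
  have subset {x : Perm (Fin 5)} (hx : x ∈ F) : inverseClosure [x] ⊆ F :=
    inverseClosure_subset hF.inv_mem (by simpa using hx)
  by_cases h6 : ∀ y ∈ F, y ^ 6 = 1
  · have hF6 : IsSymmetricGenerating 6 F := { hF with pow_eq_one := h6 }
    by_cases h2 : ∀ y ∈ F, y ^ 2 = 1
    · have hF2 : IsSymmetricGenerating 2 F := { hF with pow_eq_one := h2 }
      obtain ⟨x, hx, hne⟩ := hF.exists_ne_one
      exact hF2.containsCatalogued_of_containsConjugate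
        ((containsConjugate_of_sq_eq_one x (hF.sign_eq_one hx) (h2 x hx) hne).mono (subset hx))
        fun F' hF' hs => hF'.containsCatalogued_of_involution (hs 0)
    · push Not at h2
      obtain ⟨x, hx, hne⟩ := h2
      exact hF6.containsCatalogued_of_containsConjugate
        ((containsConjugate_of_sq_ne_one x (hF.sign_eq_one hx) (h6 x hx) hne).mono (subset hx))
        fun F' hF' hs => hF'.containsCatalogued_of_threeCycle (hs 0)
  · push Not at h6
    obtain ⟨x, hx, hne⟩ := h6
    exact hF.containsCatalogued_of_containsConjugate
      ((containsConjugate_of_pow_six_ne_one x (hF.sign_eq_one hx) hne).mono (subset hx))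
      fun F' hF' hs => hF'.containsCatalogued_of_fiveCycle (hs 0)

end IsSymmetricGenerating

end Classification

section Product

open Equiv

variable {C : Type*} [CommGroup C] {S : Set (alternatingGroup (Fin 5) × C)}

/-- The first coordinates, as permutations, of the elements of a connection set and of their
inverses. -/
def symmetricProjection (S : Set (alternatingGroup (Fin 5) × C)) : Set (Perm (Fin 5)) :=
  (fun x => (x.1 : Perm (Fin 5))) '' (S ∪ S⁻¹)

theorem isSymmetricGenerating_symmetricProjection (hS : Subgroup.closure S = ⊤) :
    IsSymmetricGenerating 0 (symmetricProjection S) where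
  inv_mem := by
    rintro _ ⟨x, hx, rfl⟩
    exact ⟨x⁻¹, by simpa [or_comm] using hx, rfl⟩
  closure_eq := by
    let f := (alternatingGroup (Fin 5)).subtype.comp (MonoidHom.fst _ C)
    calc
      Subgroup.closure (f '' (S ∪ S⁻¹)) = (Subgroup.closure S).map f := by
        rw [← MonoidHom.map_closure, Subgroup.closure_union, Subgroup.closure_inv, sup_idem]
      _ = f.range := by rw [hS, MonoidHom.range_eq_map]
      _ = alternatingGroup (Fin 5) := by
        rw [MonoidHom.range_comp, MonoidHom.range_eq_top.2 Prod.fst_surjective,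
          ← MonoidHom.range_eq_map, Subgroup.range_subtype]
  pow_eq_one y _ := pow_zero y

theorem exists_hasHamiltonianLifts_of_containsConjugate {ι : Type*} {t : ι → Perm (Fin 5)}
    (h : ContainsConjugate (symmetricProjection S) t)
    (ht : ∀ r : ι → alternatingGroup (Fin 5), (∀ i, (r i : Perm (Fin 5)) = t i) →
      HasHamiltonianLifts C r) :
    ∃ s : ι → alternatingGroup (Fin 5),
      HasHamiltonianLifts C s ∧ ∀ i, ∃ c, (s i, c) ∈ S ∨ (s i, c)⁻¹ ∈ S := by
  obtain ⟨σ, hσ⟩ := h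
  choose x hxS hx using hσ
  exact ⟨fun i => (x i).1, HasHamiltonianLifts.of_conj ht hx, fun i => ⟨(x i).2, hxS i⟩⟩

variable [Fact (Nat.card C).Prime]

theorem connectedCayleyGraphsHamiltonian_alternatingGroup_five_prod
    (hmod : Nat.card C ≡ 1 [MOD 3]) (hcard : 500 < Nat.card C) :
    ConnectedCayleyGraphsHamiltonian (alternatingGroup (Fin 5) × C) := by
  intro S hconnected
  have hS := closure_eq_top_of_mulCayley_connected hconnected
  have hA : Nat.card (alternatingGroup (Fin 5)) ≤ Nat.card C := by
    rw [nat_card_alternatingGroup_five]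
    omega
  obtain ⟨m, hm⟩ : ∃ m, Nat.card C = 3 * m + 4 := ⟨(Nat.card C - 4) / 3, by
    rw [Nat.ModEq] at hmod
    omega⟩
  rcases (isSymmetricGenerating_symmetricProjection hS).containsCatalogued with h | ⟨e, he, h⟩
  · obtain ⟨s, hs, hsS⟩ := exists_hasHamiltonianLifts_of_containsConjugate h fun r hr =>
      hasHamiltonianLifts_exceptionalPair (by omega) hm hr
    exact hs.hasHamiltonianCycle not_isSolvable_alternatingGroup_five hA hS hsS
  · obtain ⟨s, hs, hsS⟩ := exists_hasHamiltonianLifts_of_containsConjugate h fun r hr =>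
      HamiltonianCertificate.hasHamiltonianLifts hcard he hr
    exact hs.hasHamiltonianCycle not_isSolvable_alternatingGroup_five hA hS hsS

end Product

theorem infinite_setOf_prime_modEq_one {k : ℕ} (hk : k ≠ 0) (n : ℕ) :
    {p : ℕ | p.Prime ∧ p ≡ 1 [MOD k] ∧ n < p}.Infinite := by
  rw [Set.infinite_iff_exists_gt]
  intro a
  obtain ⟨p, hp, hlt, hmod⟩ := Nat.exists_prime_gt_modEq_one (a + n) hk
  exact ⟨p, ⟨hp, hmod, by omega⟩, by omega⟩

theorem not_isSolvable_prod_of_not_isSolvable_left {A C : Type*} [Group A] [Group C]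
    (hA : ¬ Group.IsSolvable A) : ¬ Group.IsSolvable (A × C) := fun _ =>
  hA (Group.isSolvable_of_surjective (f := MonoidHom.fst A C) Prod.fst_surjective)

theorem mainTheorem2 :
    ∃ (G : ℕ → Type) (_ : ∀ n, Group (G n)),
      (∀ n, Finite (G n)) ∧
      (∀ m n, m ≠ n → IsEmpty (G m ≃* G n)) ∧
      ∀ n, ConnectedCayleyGraphsHamiltonian (G n) ∧ ¬ Group.IsSolvable (G n) := by
  let f := (infinite_setOf_prime_modEq_one three_ne_zero 500).natEmbedding
  let C (n : ℕ) : Type := Multiplicative (ZMod (f n))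
  have card_C (n : ℕ) : Nat.card (C n) = f n :=
    (Nat.card_congr Multiplicative.toAdd).trans (Nat.card_zmod _)
  have hprime (n : ℕ) : (Nat.card (C n)).Prime := card_C n ▸ (f n).2.1
  have (n : ℕ) : Finite (C n) := Nat.finite_of_card_ne_zero (hprime n).ne_zero
  refine ⟨fun n => alternatingGroup (Fin 5) × C n, fun n => inferInstance,
    fun n => inferInstance, fun m n hmn => ⟨fun e => hmn ?_⟩, fun n => ⟨?_, ?_⟩⟩
  · have hcard := Nat.card_congr e.toEquiv
    rw [Nat.card_prod, Nat.card_prod, card_C, card_C, nat_card_alternatingGroup_five] at hcard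
    exact f.injective (Subtype.ext (Nat.eq_of_mul_eq_mul_left (by norm_num) hcard))
  · have : Fact (Nat.card (C n)).Prime := ⟨hprime n⟩
    exact connectedCayleyGraphsHamiltonian_alternatingGroup_five_prod (card_C n ▸ (f n).2.2.1)
      (card_C n ▸ (f n).2.2.2)
  · exact not_isSolvable_prod_of_not_isSolvable_left not_isSolvable_alternatingGroup_five
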